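/- Let $N\ge 1$ and let $G_R=(V,E_R)$, $G_T=(V,E_T)$ be strongly connected directed graphs on $V=\{1,\dots,N\}$. For $1\le i\le N$ let $\delta_i^R,\delta_i^T>0$ and let $f_i^U,f_i^T,g_i^U,g_i^R:[0,1]^N\to\mathbb{R}$ be twice continuously differentiable functions that vanish at the origin such that, for all $i,j,k$: - $f_i^U$ and $f_i^T$ each depend on $x_j$ if and only if $(i,j)\in E_R$, and $g_i^U$ and $g_i^R$ each depend on $x_j$ if and only if $(i,j)\in E_T$; - $f_i^U\ge f_i^T$ and $g_i^U\ge g_i^R$ on $[0,1]^N$; - for each $h\in\{f_i^U,f_i^T,g_i^U,g_i^R\}$, $\partial h/\partial x_j>0$ on $[0,1]^N$ if $h$ depends on $x_j$, and $\partial^2h/\partial x_j\partial x_k\le 0$ on $[0,1]^N$. Consider the generic URTU model, for $\mathbf R=(R_1,\dots,R_N)$ and $\mathbf T=(T_1,\dots,T_N)$, $$\begin{aligned} \frac{dR_i}{dt}&=(1-R_i-T_i)f_i^U(\mathbf R)-\delta_i^RR_i+T_if_i^T(\mathbf R)-R_ig_i^R(\mathbf T),\\ \frac{dT_i}{dt}&=(1-R_i-T_i)g_i^U(\mathbf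 T)-\delta_i^TT_i+R_ig_i^R(\mathbf T)-T_if_i^T(\mathbf R), \end{aligned}\qquad 1\le i\le N,$$ and put $\Omega=\{(\mathbf R,\mathbf T)\in\mathbb{R}_+^{2N}: R_i+T_i\le 1,\ 1\le i\le N\}$, $$\mathbf Q_1=\Big(\frac{\partial f_i^U}{\partial x_j}(\mathbf 0)\Big)_{i,j}-\mathrm{diag}(\delta_i^R),\qquad \mathbf Q_2=\Big(\frac{\partial g_i^U}{\partial x_j}(\mathbf 0)\Big)_{i,j}-\mathrm{diag}(\delta_i^T).$$ Let $s(\mathbf A)$ denote the maximum real part of an eigenvalue of $\mathbf A$. **Theorem 3.** Suppose $s(\mathbf Q_1)>0$ and $s(\mathbf Q_2)\le 0$. Then the model has a unique rumor-dominant equilibrium $\mathbf E_R=(\mathbf R^*,\mathbf 0)$, that is, a unique equilibrium with $\mathbf R\ne\mathbf 0$ and $\mathbf T=\mathbf 0$, and $\mathbf E_R$ attracts $\{(\mathbf R,\mathbf T)\in\Omega:\mathbf R\ne\mathbf 0\}$: from every state of this set a solution on $[0,\infty)$ starts, and every such solution converges to $\mathbf E_R$ as $t\to\infty$. Hence, writing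 $R(t)=\frac1N\sum_iR_i(t)$, $T(t)=\frac1N\sum_iT_i(t)$ and $R^*=\frac1N\sum_iR_i^*$, for every solution that starts in $\Omega$ with $R(0)\ne0$ we have $R(t)\to R^*$ and $T(t)\to0$ as $t\to\infty$. -/

import Mathlib

open Filter Topology

noncomputable section

namespace URTU

/-- The cube `[0,1]^N`, on which the spreading rates are defined. -/
def cube (N : ℕ) : Set (Fin N → ℝ) := Set.Icc 0 1

/-- The partial derivative `∂f/∂x_j` on the closed cube (one-sided at its faces). -/
def partialDeriv {N : ℕ} (f : (Fin N → ℝ) → ℝ) (j : Fin N) (x : Fin N → ℝ) : ℝ :=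
  fderivWithin ℝ f (cube N) x (Pi.single j 1)

/-- The function `f` on the cube depends upon its `j`-th argument. -/
def DependsOnArg {N : ℕ} (f : (Fin N → ℝ) → ℝ) (j : Fin N) : Prop :=
  ∃ x ∈ cube N, ∃ y ∈ cube N, (∀ k, k ≠ j → x k = y k) ∧ f x ≠ f y

/-- Every vertex is joined to every other one by a directed path. -/
def StronglyConnected {N : ℕ} (G : Digraph (Fin N)) : Prop :=
  ∀ i j, Relation.ReflTransGen G.Adj i j

/-- Conditions on a family `f_1, …, f_N` of spreading rates over the network `G`, where
`G.Adj i j` means that person `j` can pass the message to person `i`. -/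
structure IsSpreadingRate {N : ℕ} (G : Digraph (Fin N)) (f : Fin N → (Fin N → ℝ) → ℝ) :
    Prop where
  proximity : ∀ i j, DependsOnArg (f i) j ↔ G.Adj i j
  nullity : ∀ i, f i 0 = 0
  smoothness : ∀ i, ContDiffOn ℝ 2 (f i) (cube N)
  monotonicity : ∀ i j, DependsOnArg (f i) j → ∀ x ∈ cube N, 0 < partialDeriv (f i) j x
  concavity : ∀ i j k, ∀ x ∈ cube N, partialDeriv (partialDeriv (f i) k) j x ≤ 0

/-- The data and standing assumptions of the generic
uncertain-rumor-truth-uncertain (URTU) model with `N` persons. -/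
structure Model (N : ℕ) where
  /-- the rumor-spreading network -/
  GR : Digraph (Fin N)
  /-- the truth-spreading network -/
  GT : Digraph (Fin N)
  /-- rumor-spreading rates to uncertain persons -/
  fU : Fin N → (Fin N → ℝ) → ℝ
  /-- rumor-spreading rates to truth-believers -/
  fT : Fin N → (Fin N → ℝ) → ℝ
  /-- truth-spreading rates to uncertain persons -/
  gU : Fin N → (Fin N → ℝ) → ℝ
  /-- truth-spreading rates to rumor-believers -/
  gR : Fin N → (Fin N → ℝ) → ℝ
  /-- rates at which rumor-believers become uncertain -/
  δR : Fin N → ℝ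
  /-- rates at which truth-believers become uncertain -/
  δT : Fin N → ℝ
  connected_GR : StronglyConnected GR
  connected_GT : StronglyConnected GT
  fU_rate : IsSpreadingRate GR fU
  fT_rate : IsSpreadingRate GR fT
  gU_rate : IsSpreadingRate GT gU
  gR_rate : IsSpreadingRate GT gR
  ordering_f : ∀ i, ∀ x ∈ cube N, fT i x ≤ fU i x
  ordering_g : ∀ i, ∀ x ∈ cube N, gR i x ≤ gU i x
  δR_pos : ∀ i, 0 < δR i
  δT_pos : ∀ i, 0 < δT i

/-- A state is a pair `(R, T)`. -/
abbrev State (N : ℕ) : Type := (Fin N → ℝ) × (Fin N → ℝ)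

/-- The set `Ω`. -/
def Omega (N : ℕ) : Set (State N) :=
  {E | ∀ i, 0 ≤ E.1 i ∧ 0 ≤ E.2 i ∧ E.1 i + E.2 i ≤ 1}

/-- The set on which the vector field of the model is defined. -/
def domain (N : ℕ) : Set (State N) := cube N ×ˢ cube N

/-- The arithmetic mean `(1/N) ∑ x_i`. -/
def mean {N : ℕ} (x : Fin N → ℝ) : ℝ := (1 / (N : ℝ)) * ∑ i, x i

/-- `s(A)`: the maximum real part of a (complex) eigenvalue of the real matrix `A`. -/
def spectralAbscissa {N : ℕ} (A : Matrix (Fin N) (Fin N) ℝ) : ℝ :=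
  sSup (Complex.re '' spectrum ℂ (A.map Complex.ofReal))

/-- The Jacobian matrix at the origin. -/
def jacobianZero {N : ℕ} (f : Fin N → (Fin N → ℝ) → ℝ) : Matrix (Fin N) (Fin N) ℝ :=
  Matrix.of fun i j => partialDeriv (f i) j 0

namespace Model

variable {N : ℕ}

/-- The vector field of the model. -/
def field (M : Model N) (E : State N) : State N :=
  (fun i => (1 - E.1 i - E.2 i) * M.fU i E.1 - M.δR i * E.1 i
      + E.2 i * M.fT i E.1 - E.1 i * M.gR i E.2,
   fun i => (1 - E.1 i - E.2 i) * M.gU i E.2 - M.δT i * E.2 i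
      + E.1 i * M.gR i E.2 - E.2 i * M.fT i E.1)

/-- `x` is a solution of the model on `[0, ∞)`; its values lie where the vector field is
defined. -/
def IsSolution (M : Model N) (x : ℝ → State N) : Prop :=
  ∀ t, 0 ≤ t → x t ∈ domain N ∧ HasDerivWithinAt x (M.field (x t)) (Set.Ici 0) t

/-- Rumor-dominant equilibria: equilibria `(R, T)` with `R ≠ 0` and `T = 0`. -/
def IsRumorDominantEquilibrium (M : Model N) (E : State N) : Prop :=
  E ∈ domain N ∧ M.field E = 0 ∧ E.1 ≠ 0 ∧ E.2 = 0

/-- `E` attracts `A`: from every state in `A` a solution on `[0, ∞)` starts, and every solution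
that starts there converges to `E`. -/
def Attracts (M : Model N) (E : State N) (A : Set (State N)) : Prop :=
  ∀ x₀ ∈ A, (∃ x, M.IsSolution x ∧ x 0 = x₀) ∧
    ∀ x, M.IsSolution x → x 0 = x₀ → Tendsto x atTop (𝓝 E)

/-- `Q₁`. -/
def Q1 (M : Model N) : Matrix (Fin N) (Fin N) ℝ := jacobianZero M.fU - Matrix.diagonal M.δR

/-- `Q₂`. -/
def Q2 (M : Model N) : Matrix (Fin N) (Fin N) ℝ := jacobianZero M.gU - Matrix.diagonal M.δT

end Model

end URTU

end

/-! The engine is a maximum principle for ratios of coordinates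
(`eventually_forall_le_of_deriv_lt`). Since first partials are nonnegative and decrease in every
direction, each rate is monotone, lies below its linearization at the origin and is subhomogeneous.
At an index where a suitable ratio is maximal, these bounds control the derivative of that ratio.

Truth (`eventually_snd_le`): Perron–Frobenius gives `v > 0` with `Q₂ v = s(Q₂) v ≤ 0`. Where `T_i /
v_i` is maximal, the linear bound yields `T_i' ≤ -δ_i T_i ^ 2`. The square comes from the saturation
factor `1 - T_i`, so even `s(Q₂) = 0` forces `T → 0`, whatever the rumor does.

Rumor: if `s(Q₁) > 0`, a small multiple of the Perron vector is a subsolution, and a monotone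
fixed-point argument gives a positive equilibrium `y` of the rumor-only system
(`exists_pos_equilibrium`). By subhomogeneity the maximum of `R_i / y_i` has upper limit at most 1,
since truth only weakens the rumor (`eventually_fst_le`). So has the maximum of `y_i / R_i`, once
the truth is small (`eventually_le_fst`); strong connectivity makes `R` positive at positive times,
so this ratio makes sense. Uniqueness is a consequence of attraction, because an equilibrium is a
constant solution. -/

namespace URTU

/-! ### Differential inequalities and barriers -/

/-- A finite family of functions stays below an affine barrier, if the largest of them crosses
the barrier downwards whenever it touches it. -/
lemma forall_le_affine_of_deriv_lt {ι : Type*} [Finite ι] {u u' : ι → ℝ → ℝ} {a b p q : ℝ}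
    (hu : ∀ i, ∀ t, a ≤ t → HasDerivWithinAt (u i) (u' i t) (Set.Ici a) t)
    (ha : ∀ i, u i a ≤ p)
    (h : ∀ i, ∀ t, a ≤ t → t < b → (∀ j, u j t ≤ u i t) → u i t = p - q * (t - a) →
      u' i t < -q) :
    ∀ t, a ≤ t → t ≤ b → ∀ i, u i t ≤ p - q * (t - a) := by
  have hcont : ∀ i, ContinuousOn (u i) (Set.Ici a) := fun i t ht =>
    (hu i t ht).continuousWithinAt
  have hB : Continuous fun t : ℝ => p - q * (t - a) := by fun_prop
  set S : Set ℝ := {t | ∀ i, u i t ≤ p - q * (t - a)} with hS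
  have hclosed : IsClosed (S ∩ Set.Icc a b) := by
    have : S ∩ Set.Icc a b = Set.Icc a b ∩ ⋂ i, {t ∈ Set.Icc a b | u i t ≤ p - q * (t - a)} := by
      ext t
      simp only [hS, Set.mem_inter_iff, Set.mem_ofPred_eq, Set.mem_iInter]
      constructor
      · rintro ⟨h1, h2⟩; exact ⟨h2, fun i => ⟨h2, h1 i⟩⟩
      · rintro ⟨h1, h2⟩; exact ⟨fun i => (h2 i).2, h1⟩
    rw [this]
    refine isClosed_Icc.inter (isClosed_iInter fun i => ?_)
    exact isClosed_Icc.isClosed_le ((hcont i).mono Set.Icc_subset_Ici_self) hB.continuousOn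
  have key : Set.Icc a b ⊆ S := by
    -- Continuous induction: the good set is closed, and each of its points has a right
    -- neighbourhood inside it.
    refine hclosed.Icc_subset_of_forall_mem_nhdsWithin ?_ ?_
    · intro i; simpa using ha i
    · rintro x ⟨hxS, hax, hxb⟩
      have : ∀ i, ∀ᶠ t in 𝓝[>] x, u i t ≤ p - q * (t - a) := by
        intro i
        have hsub : Set.Ioi x ⊆ Set.Ici a := fun t ht => le_of_lt (lt_of_le_of_lt hax ht)
        rcases (hxS i).lt_or_eq with hlt | heq
        · have h1 : ContinuousWithinAt (u i) (Set.Ioi x) x := (hcont i x hax).mono hsub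
          have h2 : ContinuousWithinAt (fun t : ℝ => p - q * (t - a)) (Set.Ioi x) x :=
            hB.continuousWithinAt
          exact (h1.eventually_lt h2 hlt).mono fun _ => le_of_lt
        -- At a touching time no function exceeds the barrier, so `i` is a maximizing index and `h`
        -- applies. The gap has negative right derivative.
        · have hd := h i x hax hxb (fun j => heq ▸ hxS j) heq
          have h1 : HasDerivWithinAt (fun t => u i t - (p - q * (t - a))) (u' i x - -q)
              (Set.Ioi x) x := by
            refine ((hu i x hax).mono hsub).sub ?_
            have := (((hasDerivAt_id x).sub_const a).const_mul q).const_sub p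
            simpa using this.hasDerivWithinAt
          have h2 := (hasDerivWithinAt_iff_tendsto_slope' (by simp)).1 h1
          have h3 := h2.eventually (eventually_lt_nhds (sub_neg.2 hd))
          filter_upwards [h3, self_mem_nhdsWithin] with t ht htx
          have htx' : 0 < t - x := sub_pos.2 htx
          rw [slope_def_field, div_lt_iff₀ htx', zero_mul] at ht
          linarith
      exact eventually_all.2 this
  exact fun t hat htb i => key ⟨hat, htb⟩ i

/-- If the largest function of a finite family decreases at a rate bounded away from zero
whenever it is at least `ε`, then the family is eventually at most `ε`. -/
lemma eventually_forall_le_of_deriv_lt {ι : Type*} [Finite ι] {u u' : ι → ℝ → ℝ} {a ε η : ℝ}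
    (hη : 0 < η) (hu : ∀ i, ∀ t, a ≤ t → HasDerivWithinAt (u i) (u' i t) (Set.Ici a) t)
    (h : ∀ i, ∀ t, a ≤ t → (∀ j, u j t ≤ u i t) → ε ≤ u i t → u' i t < -η) :
    ∀ᶠ t in atTop, ∀ i, u i t ≤ ε := by
  obtain ⟨p, hp⟩ : ∃ p, ∀ i, u i a ≤ p := by
    obtain ⟨p, hp⟩ := (Set.finite_range fun i => u i a).bddAbove
    exact ⟨p, fun i => hp ⟨i, rfl⟩⟩
  set P := max p ε
  -- The time at which the line of slope `-η` from height `P` reaches `ε`; until then a function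
  -- touching it is at least `ε`.
  set b := a + (P - ε) / η with hb
  have hab : a ≤ b := by
    have : 0 ≤ (P - ε) / η := div_nonneg (sub_nonneg.2 (le_max_right _ _)) hη.le
    linarith
  have hηb : η * (b - a) = P - ε := by rw [hb]; field_simp; ring
  have h1 := forall_le_affine_of_deriv_lt (b := b) (p := P) (q := η) hu
    (fun i => (hp i).trans (le_max_left _ _)) (by
      intro i t hat htb hmax heq
      refine h i t hat hmax ?_
      have : η * (t - a) ≤ η * (b - a) := by gcongr
      linarith) b hab le_rfl
  filter_upwards [eventually_ge_atTop b] with t ht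
  -- From time `b` on, the constant barrier `ε` prevents a return.
  have h2 := forall_le_affine_of_deriv_lt (u := u) (u' := u') (a := b) (b := t) (p := ε) (q := 0)
    (fun i s hs => (hu i s (hab.trans hs)).mono (Set.Ici_subset_Ici.2 hab))
    (fun i => by linarith [h1 i]) (by
      intro i s hbs _ hmax heq
      have := h i s (hab.trans hbs) hmax (by linarith)
      linarith) t ht le_rfl
  intro i
  linarith [h2 i]

/-- A function that does not decrease where it is negative stays nonnegative. -/
lemma nonneg_of_deriv_nonneg_of_neg {g g' : ℝ → ℝ} {a : ℝ}
    (hg : ∀ t, a ≤ t → HasDerivWithinAt g (g' t) (Set.Ici a) t) (ha : 0 ≤ g a)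
    (h : ∀ t, a ≤ t → g t < 0 → 0 ≤ g' t) : ∀ t, a ≤ t → 0 ≤ g t := by
  intro t hat
  -- The barrier for `-g` is positive and rises at rate `ε`: touching it means `g < 0`, hence `-g' ≤
  -- 0 < ε`.
  have key : ∀ ε > 0, -g t ≤ ε + ε * (t - a) := by
    intro ε hε
    have := forall_le_affine_of_deriv_lt (ι := Unit) (u := fun _ s => -g s)
      (u' := fun _ s => -g' s) (a := a) (b := t) (p := ε) (q := -ε)
      (fun _ s hs => (hg s hs).neg) (fun _ => by linarith) (by
        intro _ s has _ _ heq
        have : 0 ≤ ε * (s - a) := mul_nonneg hε.le (sub_nonneg.2 has)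
        have := h s has (by linarith)
        linarith) t hat le_rfl ()
    linarith
  have hlim : Tendsto (fun ε : ℝ => ε + ε * (t - a)) (𝓝[>] 0) (𝓝 0) := by
    have : Continuous fun ε : ℝ => ε + ε * (t - a) := by fun_prop
    simpa using (this.tendsto 0).mono_left nhdsWithin_le_nhds
  have := ge_of_tendsto hlim (by
    filter_upwards [self_mem_nhdsWithin] with ε hε using key ε hε)
  linarith

end URTU

/-! ### Perron–Frobenius theory -/

namespace URTU

open Matrix in
/-- A nonnegative matrix with positive diagonal and strongly connected graph has a power with
positive entries. -/
lemma exists_pow_pos {ι : Type*} [Fintype ι] [DecidableEq ι] {B : Matrix ι ι ℝ}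
    (hB : ∀ i j, 0 ≤ B i j) (hdiag : ∀ i, 0 < B i i)
    (hconn : ∀ i j, Relation.ReflTransGen (fun i j => 0 < B i j) i j) :
    ∃ k : ℕ, ∀ i j, 0 < (B ^ k) i j := by
  have hpow : ∀ k i j, 0 ≤ (B ^ k) i j := fun k => pow_apply_nonneg hB k
  have step : ∀ k i j l, 0 < (B ^ k) i j → 0 < B j l → 0 < (B ^ (k + 1)) i l := by
    intro k i j l h1 h2
    rw [pow_succ, mul_apply]
    exact Finset.sum_pos' (fun m _ => mul_nonneg (hpow _ _ _) (hB _ _))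
      ⟨j, Finset.mem_univ _, mul_pos h1 h2⟩
  have mono : ∀ i j k l, k ≤ l → 0 < (B ^ k) i j → 0 < (B ^ l) i j := by
    intro i j k l hkl h
    induction l, hkl using Nat.le_induction with
    | base => exact h
    | succ l _ ih => exact step l i j j ih (hdiag j)
  have hex : ∀ i j, ∃ k, 0 < (B ^ k) i j := by
    intro i j
    induction hconn i j with
    | refl => exact ⟨0, by simp⟩
    | tail _ h2 ih =>
      obtain ⟨k, hk⟩ := ih
      exact ⟨k + 1, step k _ _ _ hk h2⟩
  choose k hk using hex
  -- The positive diagonal keeps entries positive in higher powers, so any common upper bound of the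
  -- exponents works.
  refine ⟨∑ i, ∑ j, k i j, fun i j => mono i j _ _ ?_ (hk i j)⟩
  exact (Finset.single_le_sum (f := fun j => k i j) (fun _ _ => Nat.zero_le _)
    (Finset.mem_univ j)).trans (Finset.single_le_sum (f := fun i => ∑ j, k i j)
      (fun _ _ => Nat.zero_le _) (Finset.mem_univ i))

open Matrix in
/-- **Perron's theorem**: a nonnegative matrix, some power of which has only positive entries,
has a positive eigenvector. -/
lemma exists_pos_eigenvector_of_pow_pos {ι : Type*} [Fintype ι] [DecidableEq ι] [Nonempty ι]
    {B : Matrix ι ι ℝ} (hB : ∀ i j, 0 ≤ B i j) {k : ℕ} (hk : ∀ i j, 0 < (B ^ k) i j) :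
    ∃ (v : ι → ℝ) (r : ℝ), (∀ i, 0 < v i) ∧ B *ᵥ v = r • v := by
  have hPpos : ∀ z : ι → ℝ, 0 ≤ z → z ≠ 0 → ∀ i, 0 < (B ^ k *ᵥ z) i := by
    intro z hz hz0 i
    obtain ⟨j, hj⟩ := Function.ne_iff.1 hz0
    exact Finset.sum_pos' (fun m _ => mul_nonneg (hk i m).le (hz m))
      ⟨j, Finset.mem_univ _, mul_pos (hk i j) (lt_of_le_of_ne (hz j) (Ne.symm hj))⟩
  set C : ℝ := ∑ i, ∑ j, B i j
  -- Collatz–Wielandt: the eigenvalue is the largest `r` with `r x ≤ B x` for some `x` in the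
  -- simplex.
  set K : Set (ℝ × (ι → ℝ)) :=
    {p ∈ Set.Icc 0 C ×ˢ stdSimplex ℝ ι | p.1 • p.2 ≤ B *ᵥ p.2} with hK
  have hbound : ∀ (r : ℝ) (x : ι → ℝ), x ∈ stdSimplex ℝ ι → r • x ≤ B *ᵥ x → r ≤ C := by
    intro r x hx hr
    have h1 : ∑ i, (r • x) i ≤ ∑ i, (B *ᵥ x) i := Finset.sum_le_sum fun i _ => hr i
    have h2 : ∑ i, (r • x) i = r := by
      simp [← Finset.mul_sum, hx.2]
    have h3 : ∑ i, (B *ᵥ x) i ≤ C := by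
      refine Finset.sum_le_sum fun i _ => Finset.sum_le_sum fun j _ => ?_
      have : x j ≤ 1 := hx.2 ▸ Finset.single_le_sum (fun m _ => hx.1 m) (Finset.mem_univ j)
      exact mul_le_of_le_one_right (hB i j) this
    linarith
  have hKc : IsCompact K := by
    refine (isCompact_Icc.prod (isCompact_stdSimplex ℝ ι)).of_isClosed_subset ?_
      (Set.sep_subset _ _)
    refine (isClosed_Icc.prod (isClosed_stdSimplex ℝ ι)).inter (isClosed_le
      (continuous_fst.smul continuous_snd) ?_)
    exact continuous_const.matrix_mulVec continuous_snd
  have hC : 0 ≤ C := Finset.sum_nonneg fun i _ => Finset.sum_nonneg fun j _ => hB i j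
  have hKne : K.Nonempty := by
    obtain ⟨i⟩ := ‹Nonempty ι›
    refine ⟨(0, Pi.single i 1), ⟨⟨⟨le_rfl, hC⟩, single_mem_stdSimplex ℝ i⟩, ?_⟩⟩
    intro j
    simpa using hB j i
  obtain ⟨⟨r, x⟩, ⟨⟨⟨hr0, hrC⟩, hx⟩, hle⟩, hmax⟩ :=
    hKc.exists_isMaxOn hKne continuous_fst.continuousOn
  simp only at hr0 hrC hx hle
  have hx0 : x ≠ 0 := by
    rintro rfl
    simpa using hx.2
  have heq : B *ᵥ x = r • x := by
    by_contra hne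
    set z := B *ᵥ x - r • x with hz
    have hzpos := hPpos z (sub_nonneg.2 hle) (sub_ne_zero.2 hne)
    set y := B ^ k *ᵥ x with hy
    have hypos : ∀ i, 0 < y i := hPpos x (fun i => hx.1 i) hx0
    have hBy : B *ᵥ y - r • y = B ^ k *ᵥ z := by
      rw [hz, hy, mulVec_sub, mulVec_mulVec, mulVec_mulVec, mulVec_smul, ← pow_succ, ← pow_succ']
    obtain ⟨ε, hε, hεle⟩ : ∃ ε > 0, ∀ i, ε * y i ≤ (B ^ k *ᵥ z) i := by
      obtain ⟨i₀, hi₀⟩ := Finite.exists_min fun i => (B ^ k *ᵥ z) i / y i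
      exact ⟨_, div_pos (hzpos i₀) (hypos i₀), fun i => (le_div_iff₀ (hypos i)).1 (hi₀ i)⟩
    have hs : 0 < ∑ i, y i := Finset.sum_pos (fun i _ => hypos i) Finset.univ_nonempty
    set w := (∑ i, y i)⁻¹ • y with hw
    have hwS : w ∈ stdSimplex ℝ ι := by
      refine ⟨fun i => mul_nonneg (inv_nonneg.2 hs.le) (hypos i).le, ?_⟩
      simp [hw, ← Finset.mul_sum, hs.ne']
    have hwle : (r + ε) • w ≤ B *ᵥ w := by
      intro i
      have h1 : (B *ᵥ y) i - r * y i = (B ^ k *ᵥ z) i := congrFun hBy i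
      have h2 : (r + ε) * y i ≤ (B *ᵥ y) i := by linarith [hεle i]
      rw [hw, mulVec_smul, smul_comm]
      exact mul_le_mul_of_nonneg_left h2 (inv_nonneg.2 hs.le)
    have h3 : (r + ε, w) ∈ K :=
      ⟨⟨⟨by positivity, hbound _ _ hwS hwle⟩, hwS⟩, hwle⟩
    have h4 : r + ε ≤ r := hmax h3
    linarith
  have hpow : ∀ m : ℕ, B ^ m *ᵥ x = r ^ m • x := by
    intro m
    induction m with
    | zero => simp
    | succ m ih => rw [pow_succ', ← mulVec_mulVec, ih, mulVec_smul, heq, smul_smul, pow_succ]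
  refine ⟨x, r, fun i => ?_, heq⟩
  have h1 := hPpos x (fun i => hx.1 i) hx0 i
  rw [hpow] at h1
  exact lt_of_le_of_ne (hx.1 i) fun h => by simp [← h] at h1

/-- **Perron–Frobenius** for irreducible matrices with nonnegative off-diagonal entries. -/
lemma exists_pos_eigenvector {ι : Type*} [Fintype ι] [DecidableEq ι] [Nonempty ι]
    {Q : Matrix ι ι ℝ} (hQ : ∀ i j, i ≠ j → 0 ≤ Q i j)
    (hconn : ∀ i j, Relation.ReflTransGen (fun i j => i ≠ j → 0 < Q i j) i j) :
    ∃ (v : ι → ℝ) (r : ℝ), (∀ i, 0 < v i) ∧ Q.mulVec v = r • v := by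
  -- Adding `c` times the identity makes the diagonal positive and keeps the eigenvectors.
  set c : ℝ := ∑ i, |Q i i| + 1 with hc
  have hci : ∀ i, 0 < Q i i + c := by
    intro i
    have h1 : |Q i i| ≤ ∑ i, |Q i i| :=
      Finset.single_le_sum (f := fun i => |Q i i|) (fun _ _ => abs_nonneg _) (Finset.mem_univ i)
    have := neg_abs_le (Q i i)
    linarith
  set B : Matrix ι ι ℝ := Q + c • (1 : Matrix ι ι ℝ) with hBdef
  have hoff : ∀ i j, i ≠ j → B i j = Q i j := fun i j h => by simp [hBdef, h]
  have hdiag : ∀ i, 0 < B i i := fun i => by simpa [hBdef] using hci i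
  have hB : ∀ i j, 0 ≤ B i j := by
    intro i j
    rcases eq_or_ne i j with rfl | h
    · exact (hdiag i).le
    · rw [hoff i j h]; exact hQ i j h
  have hmono : ∀ a b, (a ≠ b → 0 < Q a b) → 0 < B a b := by
    intro a b hab
    rcases eq_or_ne a b with rfl | h
    · exact hdiag a
    · rw [hoff a b h]; exact hab h
  obtain ⟨k, hk⟩ := exists_pow_pos hB hdiag fun i j => (Relation.ReflTransGen.mono hmono) _ _ (hconn i j)
  obtain ⟨v, r, hv, hvr⟩ := exists_pos_eigenvector_of_pow_pos hB hk
  refine ⟨v, r - c, hv, ?_⟩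
  have : Q.mulVec v + c • v = r • v := by
    rw [← hvr, hBdef, Matrix.add_mulVec, Matrix.smul_mulVec, Matrix.one_mulVec]
  rw [sub_smul, ← this, add_sub_cancel_right]

/-- The eigenvalue that belongs to a positive eigenvector is a spectral value. -/
lemma ofReal_mem_spectrum {ι : Type*} [Fintype ι] [DecidableEq ι] [Nonempty ι]
    {Q : Matrix ι ι ℝ} {v : ι → ℝ} {r : ℝ} (hv : ∀ i, 0 < v i) (hvr : Q.mulVec v = r • v) :
    (r : ℂ) ∈ spectrum ℂ (Q.map Complex.ofReal) := by
  rw [← Matrix.spectrum_toLin', ← Module.End.hasEigenvalue_iff_mem_spectrum]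
  refine Module.End.hasEigenvalue_of_hasEigenvector (x := fun i => (v i : ℂ)) ⟨?_, ?_⟩
  · rw [Module.End.mem_eigenspace_iff, Matrix.toLin'_apply]
    ext i
    have := congrFun hvr i
    simp only [Matrix.mulVec, dotProduct, Matrix.map_apply, Pi.smul_apply, smul_eq_mul] at this ⊢
    exact_mod_cast this
  · intro h
    obtain ⟨i⟩ := ‹Nonempty ι›
    have := congrFun h i
    simp [(hv i).ne'] at this

/-- The eigenvalue that belongs to a positive eigenvector of a matrix with nonnegative
off-diagonal entries bounds the real parts of all eigenvalues. -/
lemma re_le_of_mem_spectrum {ι : Type*} [Fintype ι] [DecidableEq ι] {Q : Matrix ι ι ℝ}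
    (hQ : ∀ i j, i ≠ j → 0 ≤ Q i j) {v : ι → ℝ} {r : ℝ} (hv : ∀ i, 0 < v i)
    (hvr : Q.mulVec v = r • v) {μ : ℂ} (hμ : μ ∈ spectrum ℂ (Q.map Complex.ofReal)) :
    μ.re ≤ r := by
  rw [← Matrix.spectrum_toLin', ← Module.End.hasEigenvalue_iff_mem_spectrum] at hμ
  obtain ⟨z, hz, hz0⟩ := hμ.exists_hasEigenvector
  rw [Module.End.mem_eigenspace_iff, Matrix.toLin'_apply] at hz
  obtain ⟨k, hk⟩ := Function.ne_iff.1 hz0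
  have : Nonempty ι := ⟨k⟩
  -- A Gershgorin estimate weighted by `v`, in the row where `‖z i‖ / v i` is largest.
  obtain ⟨i, hi⟩ := Finite.exists_max fun i => ‖z i‖ / v i
  set m := ‖z i‖ / v i with hm
  have hle : ∀ j, ‖z j‖ ≤ m * v j := fun j => (div_le_iff₀ (hv j)).1 (hi j)
  have hmi : ‖z i‖ = m * v i := by rw [hm]; field_simp [(hv i).ne']
  have hmpos : 0 < m := by
    have := hle k
    have h2 : 0 < ‖z k‖ := norm_pos_iff.2 hk
    by_contra hcon
    nlinarith [hv k]
  have hzi := congrFun hz i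
  simp only [Matrix.mulVec, dotProduct, Matrix.map_apply, Pi.smul_apply, smul_eq_mul] at hzi
  have hvi := congrFun hvr i
  simp only [Matrix.mulVec, dotProduct, Pi.smul_apply, smul_eq_mul] at hvi
  rw [← Finset.add_sum_erase _ _ (Finset.mem_univ i)] at hzi hvi
  have h1 : (μ - (Q i i : ℂ)) * z i = ∑ j ∈ Finset.univ.erase i, (Q i j : ℂ) * z j := by
    linear_combination -hzi
  have h2 : ‖(μ - (Q i i : ℂ)) * z i‖ ≤ ∑ j ∈ Finset.univ.erase i, Q i j * (m * v j) := by
    rw [h1]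
    refine (norm_sum_le _ _).trans (Finset.sum_le_sum fun j hj => ?_)
    have hq := hQ i j (Finset.ne_of_mem_erase hj).symm
    rw [norm_mul, Complex.norm_real, Real.norm_of_nonneg hq]
    exact mul_le_mul_of_nonneg_left (hle j) hq
  have h3 : ∑ j ∈ Finset.univ.erase i, Q i j * (m * v j) = m * ((r - Q i i) * v i) := by
    rw [show (r - Q i i) * v i = ∑ j ∈ Finset.univ.erase i, Q i j * v j by linarith,
      Finset.mul_sum]
    exact Finset.sum_congr rfl fun j _ => by ring
  have h4 : μ.re - Q i i ≤ ‖μ - (Q i i : ℂ)‖ := by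
    simpa using Complex.re_le_norm (μ - (Q i i : ℂ))
  rw [norm_mul, hmi, h3] at h2
  have h5 : 0 < m * v i := mul_pos hmpos (hv i)
  have h6 : ‖μ - (Q i i : ℂ)‖ ≤ r - Q i i := by
    refine le_of_mul_le_mul_right ?_ h5
    linarith
  linarith

end URTU

/-! ### Calculus on the cube and properties of spreading rates -/

namespace URTU

variable {N : ℕ}

lemma mem_cube {x : Fin N → ℝ} : x ∈ cube N ↔ ∀ i, 0 ≤ x i ∧ x i ≤ 1 :=
  ⟨fun h i => ⟨h.1 i, h.2 i⟩, fun h => ⟨fun i => (h i).1, fun i => (h i).2⟩⟩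

lemma convex_cube : Convex ℝ (cube N) := convex_Icc 0 1

lemma zero_mem_cube : (0 : Fin N → ℝ) ∈ cube N := ⟨le_rfl, zero_le_one⟩

lemma smul_mem_cube {x : Fin N → ℝ} (hx : x ∈ cube N) {c : ℝ} (h0 : 0 ≤ c) (h1 : c ≤ 1) :
    c • x ∈ cube N := by
  rw [mem_cube] at hx ⊢
  exact fun i => ⟨mul_nonneg h0 (hx i).1, mul_le_one₀ h1 (hx i).1 (hx i).2⟩

/-- Makes `fderivWithin` well determined up to the boundary, in particular at the corner 0 where the
model is linearized. -/
lemma uniqueDiffOn_cube : UniqueDiffOn ℝ (cube N) := by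
  rw [cube, ← Set.pi_univ_Icc]
  exact UniqueDiffOn.univ_pi fun _ => uniqueDiffOn_Icc zero_lt_one

lemma segment_mem_cube {x y : Fin N → ℝ} (hx : x ∈ cube N) (hy : y ∈ cube N) {s : ℝ}
    (hs : s ∈ Set.Icc (0 : ℝ) 1) : x + s • (y - x) ∈ cube N :=
  convex_cube.add_smul_sub_mem hx hy hs

lemma hasDerivWithinAt_segment {f : (Fin N → ℝ) → ℝ} (hf : DifferentiableOn ℝ f (cube N))
    {x y : Fin N → ℝ} (hx : x ∈ cube N) (hy : y ∈ cube N) {s : ℝ} (hs : s ∈ Set.Icc (0 : ℝ) 1) :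
    HasDerivWithinAt (fun s : ℝ => f (x + s • (y - x)))
      (∑ j, (y j - x j) * partialDeriv f j (x + s • (y - x))) (Set.Icc 0 1) s := by
  have h1 := (hf _ (segment_mem_cube hx hy hs)).hasFDerivWithinAt
  have h2 : HasDerivWithinAt (fun s : ℝ => x + s • (y - x)) (y - x) (Set.Icc 0 1) s := by
    simpa using (((hasDerivAt_id s).smul_const (y - x)).const_add x).hasDerivWithinAt
  have h3 := h1.comp_hasDerivWithinAt s h2 fun t ht => segment_mem_cube hx hy ht
  have h4 : ∑ j, (y j - x j) * partialDeriv f j (x + s • (y - x))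
      = fderivWithin ℝ f (cube N) (x + s • (y - x)) (y - x) := by
    simp only [partialDeriv]
    generalize fderivWithin ℝ f (cube N) (x + s • (y - x)) = A
    conv_rhs => rw [← Finset.univ_sum_single (y - x), map_sum]
    refine Finset.sum_congr rfl fun j _ => ?_
    rw [← smul_eq_mul, ← map_smul, ← Pi.single_smul, smul_eq_mul, mul_one,
      Pi.sub_apply]
  rw [h4]
  exact h3

/-- The mean value theorem along a segment in the cube. -/
lemma exists_sub_eq_sum_partialDeriv {f : (Fin N → ℝ) → ℝ} (hf : DifferentiableOn ℝ f (cube N))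
    {x y : Fin N → ℝ} (hx : x ∈ cube N) (hy : y ∈ cube N) :
    ∃ s ∈ Set.Icc (0 : ℝ) 1, f y - f x = ∑ j, (y j - x j) * partialDeriv f j (x + s • (y - x)) := by
  obtain ⟨s, hs, h⟩ := exists_hasDerivAt_eq_slope (fun s : ℝ => f (x + s • (y - x)))
    (fun s => ∑ j, (y j - x j) * partialDeriv f j (x + s • (y - x))) zero_lt_one
    (fun s hs => (hasDerivWithinAt_segment hf hx hy hs).continuousWithinAt)
    (fun s hs => (hasDerivWithinAt_segment hf hx hy (Set.Ioo_subset_Icc_self hs)).hasDerivAt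
      (Icc_mem_nhds hs.1 hs.2))
  refine ⟨s, Set.Ioo_subset_Icc_self hs, ?_⟩
  simpa using h.symm

lemma monotoneOn_of_partialDeriv_nonneg {f : (Fin N → ℝ) → ℝ}
    (hf : DifferentiableOn ℝ f (cube N)) (h : ∀ j, ∀ x ∈ cube N, 0 ≤ partialDeriv f j x) :
    MonotoneOn f (cube N) := by
  intro x hx y hy hxy
  obtain ⟨s, hs, he⟩ := exists_sub_eq_sum_partialDeriv hf hx hy
  have : 0 ≤ f y - f x := he ▸ Finset.sum_nonneg fun j _ =>
    mul_nonneg (sub_nonneg.2 (hxy j)) (h j _ (segment_mem_cube hx hy hs))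
  linarith

lemma antitoneOn_of_partialDeriv_nonpos {f : (Fin N → ℝ) → ℝ}
    (hf : DifferentiableOn ℝ f (cube N)) (h : ∀ j, ∀ x ∈ cube N, partialDeriv f j x ≤ 0) :
    AntitoneOn f (cube N) := by
  intro x hx y hy hxy
  obtain ⟨s, hs, he⟩ := exists_sub_eq_sum_partialDeriv hf hx hy
  have : f y - f x ≤ 0 := he ▸ Finset.sum_nonpos fun j _ =>
    mul_nonpos_of_nonneg_of_nonpos (sub_nonneg.2 (hxy j)) (h j _ (segment_mem_cube hx hy hs))
  linarith

/-- Moving `x j` towards an endpoint of `[0,1]` other than itself leaves `f` constant; uniqueness of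
one-sided derivatives covers the faces. -/
lemma partialDeriv_eq_zero {f : (Fin N → ℝ) → ℝ} (hf : DifferentiableOn ℝ f (cube N))
    {j : Fin N} (hj : ¬ DependsOnArg f j) {x : Fin N → ℝ} (hx : x ∈ cube N) :
    partialDeriv f j x = 0 := by
  obtain ⟨a, ha0, ha1, hax⟩ : ∃ a : ℝ, 0 ≤ a ∧ a ≤ 1 ∧ a ≠ x j := by
    by_cases h : x j = 0
    · exact ⟨1, zero_le_one, le_rfl, by simp [h]⟩
    · exact ⟨0, le_rfl, zero_le_one, Ne.symm h⟩
  set y := Function.update x j a with hy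
  have hyc : y ∈ cube N := by
    rw [mem_cube] at hx ⊢
    intro i
    rcases eq_or_ne i j with rfl | h
    · simp [hy, ha0, ha1]
    · simpa [hy, h] using hx i
  have hyx : ∀ k, k ≠ j → y k = x k := fun k hk => by simp [hy, hk]
  have h0 : (0 : ℝ) ∈ Set.Icc (0 : ℝ) 1 := ⟨le_rfl, zero_le_one⟩
  have h1 := hasDerivWithinAt_segment hf hx hyc h0
  have h2 : HasDerivWithinAt (fun s : ℝ => f (x + s • (y - x))) 0 (Set.Icc 0 1) 0 := by
    refine (hasDerivWithinAt_const (0 : ℝ) (Set.Icc (0 : ℝ) 1) (f x)).congr (fun s hs => ?_)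
      (by simp)
    by_contra hne
    refine hj ⟨_, segment_mem_cube hx hyc hs, x, hx, fun k hk => ?_, hne⟩
    simp [hyx k hk]
  have h3 := (uniqueDiffOn_Icc zero_lt_one 0 h0).eq_deriv _ h1 h2
  rw [Finset.sum_eq_single j (fun k _ hk => by simp [hyx k hk]) (by simp)] at h3
  have h4 : y j - x j ≠ 0 := by simpa [hy, sub_eq_zero] using hax
  simpa [h4] using h3

namespace IsSpreadingRate

variable {G : Digraph (Fin N)} {f : Fin N → (Fin N → ℝ) → ℝ}

lemma differentiableOn (hf : IsSpreadingRate G f) (i : Fin N) :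
    DifferentiableOn ℝ (f i) (cube N) :=
  (hf.smoothness i).differentiableOn (by norm_num)

lemma partialDeriv_nonneg (hf : IsSpreadingRate G f) (i j : Fin N) {x : Fin N → ℝ}
    (hx : x ∈ cube N) : 0 ≤ partialDeriv (f i) j x := by
  by_cases h : DependsOnArg (f i) j
  · exact (hf.monotonicity i j h x hx).le
  · exact (partialDeriv_eq_zero (hf.differentiableOn i) h hx).ge

lemma monotoneOn (hf : IsSpreadingRate G f) (i : Fin N) : MonotoneOn (f i) (cube N) :=
  monotoneOn_of_partialDeriv_nonneg (hf.differentiableOn i) fun j _ hx =>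
    hf.partialDeriv_nonneg i j hx

/-- All second partials, mixed ones included, are nonpositive, so the gradient decreases in the
coordinatewise order. Both the tangent bound at 0 and subhomogeneity rest on this. -/
lemma antitoneOn_partialDeriv (hf : IsSpreadingRate G f) (i j : Fin N) :
    AntitoneOn (partialDeriv (f i) j) (cube N) := by
  refine antitoneOn_of_partialDeriv_nonpos ?_ fun k x hx => hf.concavity i k j x hx
  have h : ContDiffOn ℝ 1 (fderivWithin ℝ (f i) (cube N)) (cube N) :=
    (hf.smoothness i).fderivWithin uniqueDiffOn_cube (by norm_num)
  exact (h.differentiableOn (by norm_num)).clm_apply (differentiableOn_const _)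

lemma nonneg (hf : IsSpreadingRate G f) (i : Fin N) {x : Fin N → ℝ} (hx : x ∈ cube N) :
    0 ≤ f i x :=
  (hf.nullity i).symm.trans_le (hf.monotoneOn i zero_mem_cube hx hx.1)

lemma pos (hf : IsSpreadingRate G f) {i j : Fin N} (hij : G.Adj i j) {x : Fin N → ℝ}
    (hx : x ∈ cube N) (hxj : 0 < x j) : 0 < f i x := by
  obtain ⟨s, hs, he⟩ := exists_sub_eq_sum_partialDeriv (hf.differentiableOn i) zero_mem_cube hx
  rw [hf.nullity, sub_zero] at he
  have hc := segment_mem_cube zero_mem_cube hx hs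
  rw [he]
  refine Finset.sum_pos' (fun k _ => mul_nonneg ?_ (hf.partialDeriv_nonneg i k hc))
    ⟨j, Finset.mem_univ _, mul_pos ?_
      (hf.monotonicity i j ((hf.proximity i j).2 hij) _ hc)⟩
  · simpa using hx.1 k
  · simpa using hxj

/-- The mean value theorem from 0, with intermediate partials bounded by those at 0. -/
lemma le_sum_partialDeriv_zero (hf : IsSpreadingRate G f) (i : Fin N) {x : Fin N → ℝ}
    (hx : x ∈ cube N) : f i x ≤ ∑ j, partialDeriv (f i) j 0 * x j := by
  obtain ⟨s, hs, he⟩ := exists_sub_eq_sum_partialDeriv (hf.differentiableOn i) zero_mem_cube hx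
  rw [hf.nullity, sub_zero] at he
  have hc := segment_mem_cube zero_mem_cube hx hs
  rw [he]
  refine Finset.sum_le_sum fun j _ => ?_
  rw [mul_comm, Pi.zero_apply, sub_zero (x j)]
  exact mul_le_mul_of_nonneg_right (hf.antitoneOn_partialDeriv i j zero_mem_cube hc hc.1) (hx.1 j)

/-- Spreading rates are subhomogeneous. -/
lemma mul_le_smul (hf : IsSpreadingRate G f) (i : Fin N) {x : Fin N → ℝ} (hx : x ∈ cube N)
    {c : ℝ} (h0 : 0 ≤ c) (h1 : c ≤ 1) : c * f i x ≤ f i (c • x) := by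
  have hcx := smul_mem_cube hx h0 h1
  have hd := hf.differentiableOn i
  obtain ⟨s, hs, he⟩ := exists_sub_eq_sum_partialDeriv hd zero_mem_cube hcx
  obtain ⟨t, ht, he'⟩ := exists_sub_eq_sum_partialDeriv hd hcx hx
  have hs' := segment_mem_cube zero_mem_cube hcx hs
  have ht' := segment_mem_cube hcx hx ht
  rw [hf.nullity, sub_zero] at he
  -- `D` and `D'` are mean slopes along the ray before and after `c • x`. Since `D' ≤ D`, `c * f x =
  -- c * (c * D + (1 - c) * D') ≤ c * D = f (c • x)`.
  set D := ∑ j, x j * partialDeriv (f i) j (0 + s • (c • x - 0)) with hD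
  set D' := ∑ j, x j * partialDeriv (f i) j (c • x + t • (x - c • x)) with hD'
  have e1 : f i (c • x) = c * D := by
    rw [he, hD, Finset.mul_sum]
    exact Finset.sum_congr rfl fun j _ => by simp [mul_assoc]
  have e2 : f i x - f i (c • x) = (1 - c) * D' := by
    rw [he', hD', Finset.mul_sum]
    exact Finset.sum_congr rfl fun j _ => by simp only [Pi.smul_apply, smul_eq_mul]; ring
  have hle : D' ≤ D := by
    refine Finset.sum_le_sum fun j _ => mul_le_mul_of_nonneg_left ?_ (hx.1 j)
    refine hf.antitoneOn_partialDeriv i j hs' ht' fun k => ?_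
    have hxk := hx.1 k
    simp only [Pi.zero_apply] at hxk
    simp only [Pi.add_apply, Pi.smul_apply, Pi.sub_apply, Pi.zero_apply, smul_eq_mul]
    have : s * (c * x k) ≤ c * x k := mul_le_of_le_one_left (mul_nonneg h0 hxk) hs.2
    have : 0 ≤ t * (x k - c * x k) :=
      mul_nonneg ht.1 (by nlinarith)
    linarith
  nlinarith [mul_nonneg h0 (mul_nonneg (sub_nonneg.2 h1) (sub_nonneg.2 hle))]

/-- Close to the origin a spreading rate exceeds any bound below its linearization. -/
lemma eventually_lt_smul (hf : IsSpreadingRate G f) (i : Fin N) {v : Fin N → ℝ}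
    (hv : v ∈ cube N) {a : ℝ} (ha : a < ∑ j, partialDeriv (f i) j 0 * v j) :
    ∀ᶠ s : ℝ in 𝓝[>] 0, s * a < f i (s • v) := by
  have h1 := hasDerivWithinAt_segment (hf.differentiableOn i) zero_mem_cube hv
    (s := 0) ⟨le_rfl, zero_le_one⟩
  have h2 : Tendsto (slope (fun s : ℝ => f i (0 + s • (v - 0))) 0) (𝓝[>] 0)
      (𝓝 (∑ j, partialDeriv (f i) j 0 * v j)) := by
    have hle : 𝓝[>] (0 : ℝ) ≤ 𝓝[Set.Icc 0 1 \ {0}] 0 := by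
      refine nhdsWithin_le_iff.2 ?_
      filter_upwards [Ioc_mem_nhdsGT (zero_lt_one (α := ℝ))] with s hs
      exact ⟨⟨hs.1.le, hs.2⟩, hs.1.ne'⟩
    have := (hasDerivWithinAt_iff_tendsto_slope.1 h1).mono_left hle
    simpa [mul_comm] using this
  filter_upwards [h2.eventually (eventually_gt_nhds ha), self_mem_nhdsWithin] with s hs hs0
  have hs0' : (0 : ℝ) < s := hs0
  rw [slope_def_field, lt_div_iff₀ (by simpa using hs0')] at hs
  simpa [hf.nullity, mul_comm] using hs

end IsSpreadingRate

end URTU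

/-! ### Existence of global solutions -/

namespace URTU

/-- Bounded Lipschitz vector fields have solutions on `[0, ∞)`. -/
lemma exists_global_solution {E : Type*} [NormedAddCommGroup E] [NormedSpace ℝ E]
    [CompleteSpace E] {F : E → E} {K L : NNReal} (hK : LipschitzWith K F) (hL : ∀ x, ‖F x‖ ≤ L)
    (x₀ : E) :
    ∃ x : ℝ → E, x 0 = x₀ ∧ ∀ t, 0 ≤ t → HasDerivWithinAt x (F (x t)) (Set.Ici 0) t := by
  have hloc : ∀ n : ℕ, ∃ α : ℝ → E, α 0 = x₀ ∧
      ∀ t ∈ Set.Icc (0 : ℝ) (n + 1), HasDerivWithinAt α (F (α t)) (Set.Icc 0 (n + 1)) t := by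
    intro n
    have hn : (0 : ℝ) ≤ n + 1 := by positivity
    have hP : IsPicardLindelof (fun _ => F) (⟨0, le_rfl, hn⟩ : Set.Icc (0 : ℝ) (n + 1)) x₀
        (L * (n + 1)) 0 L K := by
      refine IsPicardLindelof.of_time_independent (fun x _ => hL x) hK.lipschitzOnWith ?_
      simp [hn]
    exact hP.exists_eq_forall_mem_Icc_hasDerivWithinAt₀
  choose α hα0 hα using hloc
  have hcont : ∀ n, ContinuousOn (α n) (Set.Icc 0 (n + 1)) := fun n t ht =>
    (hα n t ht).continuousWithinAt
  have hright : ∀ (n : ℕ) (t : ℝ), t ∈ Set.Ico (0 : ℝ) (n + 1) →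
      HasDerivWithinAt (α n) (F (α n t)) (Set.Ici t) t := by
    intro n t ht
    refine (hα n t ⟨ht.1, ht.2.le⟩).mono_of_mem_nhdsWithin ?_
    exact mem_of_superset (Icc_mem_nhdsGE ht.2) (Set.Icc_subset_Icc_left ht.1)
  have heq : ∀ m n : ℕ, m ≤ n → Set.EqOn (α m) (α n) (Set.Icc 0 (m + 1)) := by
    intro m n hmn
    have hmn' : (m : ℝ) ≤ n := by exact_mod_cast hmn
    exact ODE_solution_unique (v := fun _ => F) (fun _ => hK) (hcont m) (hright m)
      ((hcont n).mono (Set.Icc_subset_Icc_right (by linarith)))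
      (fun t ht => hright n t ⟨ht.1, by linarith [ht.2]⟩) (by rw [hα0, hα0])
  refine ⟨fun t => α ⌊t⌋₊ t, by simp [hα0], fun t ht => ?_⟩
  set n := ⌊t⌋₊ + 1 with hn
  -- The glued function is the single solution `α n` on `[0, n + 1)`, a neighbourhood of `t` in `[0,
  -- ∞)`.
  have hxα : ∀ s : ℝ, 0 ≤ s → s < n + 1 → α ⌊s⌋₊ s = α n s := by
    intro s hs hsn
    refine heq _ _ ?_ ⟨hs, (Nat.lt_floor_add_one s).le⟩
    have : ⌊s⌋₊ < n + 1 := (Nat.floor_lt hs).2 (by exact_mod_cast hsn)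
    omega
  have htn : t < n + 1 := by
    have := Nat.lt_floor_add_one t
    rw [hn]; push_cast; linarith
  have h1 : HasDerivWithinAt (α n) (F (α n t)) (Set.Ici 0) t := by
    refine (hα n t ⟨ht, htn.le⟩).mono_of_mem_nhdsWithin ?_
    filter_upwards [self_mem_nhdsWithin, mem_nhdsWithin_of_mem_nhds (Iio_mem_nhds htn)] with s h1 h2
    exact ⟨h1, le_of_lt h2⟩
  have h2 := hxα t ht htn
  simp only [h2]
  refine h1.congr_of_eventuallyEq ?_ h2
  filter_upwards [self_mem_nhdsWithin, mem_nhdsWithin_of_mem_nhds (Iio_mem_nhds htn)] with s h1 h2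
  exact hxα s h1 h2

variable {N : ℕ}

/-- The nearest point of the cube. -/
def clamp (x : Fin N → ℝ) : Fin N → ℝ := fun i => max 0 (min 1 (x i))

lemma clamp_mem_cube (x : Fin N → ℝ) : clamp x ∈ cube N :=
  mem_cube.2 fun _ => ⟨le_max_left _ _, max_le zero_le_one (min_le_left _ _)⟩

lemma clamp_of_mem {x : Fin N → ℝ} (hx : x ∈ cube N) : clamp x = x := by
  ext i
  have := mem_cube.1 hx i
  simp [clamp, this.1, this.2]

lemma lipschitzWith_clamp : LipschitzWith 1 (clamp (N := N)) := by
  have h : LipschitzWith 1 fun a : ℝ => max 0 (min 1 a) :=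
    (LipschitzWith.id.const_min 1).const_max 0
  refine LipschitzWith.of_dist_le_mul fun x y => ?_
  rw [dist_pi_le_iff (by positivity)]
  intro i
  refine (h.dist_le_mul (x i) (y i)).trans ?_
  gcongr
  exact dist_le_pi_dist x y i

namespace Model

lemma contDiffOn_field (M : Model N) : ContDiffOn ℝ 1 M.field (domain N) := by
  have h1 : ∀ (G : Digraph (Fin N)) (f : Fin N → (Fin N → ℝ) → ℝ), IsSpreadingRate G f → ∀ i,
      ContDiffOn ℝ 1 (fun E : State N => f i E.1) (domain N) := fun G f hf i =>
    ((hf.smoothness i).of_le (by norm_num)).comp contDiff_fst.contDiffOn fun E hE => hE.1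
  have h2 : ∀ (G : Digraph (Fin N)) (f : Fin N → (Fin N → ℝ) → ℝ), IsSpreadingRate G f → ∀ i,
      ContDiffOn ℝ 1 (fun E : State N => f i E.2) (domain N) := fun G f hf i =>
    ((hf.smoothness i).of_le (by norm_num)).comp contDiff_snd.contDiffOn fun E hE => hE.2
  have hR : ∀ i, ContDiffOn ℝ 1 (fun E : State N => E.1 i) (domain N) := fun i =>
    ((contDiff_apply ℝ ℝ i).comp contDiff_fst).contDiffOn
  have hT : ∀ i, ContDiffOn ℝ 1 (fun E : State N => E.2 i) (domain N) := fun i =>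
    ((contDiff_apply ℝ ℝ i).comp contDiff_snd).contDiffOn
  have hU : ∀ i, ContDiffOn ℝ 1 (fun E : State N => 1 - E.1 i - E.2 i) (domain N) := fun i =>
    (contDiffOn_const.sub (hR i)).sub (hT i)
  refine ContDiffOn.prodMk (contDiffOn_pi.2 fun i => ?_) (contDiffOn_pi.2 fun i => ?_)
  · exact ((((hU i).mul (h1 _ _ M.fU_rate i)).sub (contDiffOn_const.mul (hR i))).add
      ((hT i).mul (h1 _ _ M.fT_rate i))).sub ((hR i).mul (h2 _ _ M.gR_rate i))
  · exact ((((hU i).mul (h2 _ _ M.gU_rate i)).sub (contDiffOn_const.mul (hT i))).add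
      ((hR i).mul (h2 _ _ M.gR_rate i))).sub ((hT i).mul (h1 _ _ M.fT_rate i))

lemma isCompact_domain : IsCompact (domain N) := isCompact_Icc.prod isCompact_Icc

lemma exists_lipschitzOnWith_field (M : Model N) :
    ∃ K, LipschitzOnWith K M.field (domain N) := by
  have h := M.contDiffOn_field
  have hc := h.continuousOn_fderivWithin (uniqueDiffOn_cube.prod uniqueDiffOn_cube) le_rfl
  obtain ⟨C, hC⟩ := isCompact_domain.exists_bound_of_continuousOn hc
  refine ⟨C.toNNReal, (convex_cube.prod convex_cube).lipschitzOnWith_of_nnnorm_fderivWithin_le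
    (h.differentiableOn (by norm_num)) fun x hx => ?_⟩
  rw [← NNReal.coe_le_coe, coe_nnnorm]
  exact (hC x hx).trans (Real.le_coe_toNNReal C)

/-- Every state with both components in the cube starts a solution. -/
lemma exists_isSolution (M : Model N) {x₀ : State N} (hx₀ : x₀ ∈ domain N) :
    ∃ x, M.IsSolution x ∧ x 0 = x₀ := by
  -- The field composed with the retraction `P` is bounded and Lipschitz everywhere. Its solutions
  -- never leave the box, where `P` is the identity, so they solve the model.
  set P : State N → State N := fun E => (clamp E.1, clamp E.2) with hP
  have hPmem : ∀ E, P E ∈ domain N := fun E => ⟨clamp_mem_cube _, clamp_mem_cube _⟩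
  have hPlip : LipschitzWith 1 P := by
    have := (lipschitzWith_clamp (N := N)).comp (LipschitzWith.prod_fst (β := Fin N → ℝ))
    have h2 := (lipschitzWith_clamp (N := N)).comp (LipschitzWith.prod_snd (α := Fin N → ℝ))
    simpa using this.prodMk h2
  obtain ⟨K, hK⟩ := M.exists_lipschitzOnWith_field
  obtain ⟨C, hC⟩ := isCompact_domain.exists_bound_of_continuousOn M.contDiffOn_field.continuousOn
  have hF : LipschitzWith (K * 1) (fun E => M.field (P E)) := by
    rw [← lipschitzOnWith_univ]
    exact hK.comp hPlip.lipschitzOnWith fun E _ => hPmem E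
  obtain ⟨x, hx0, hx⟩ := exists_global_solution (L := C.toNNReal) hF
    (fun E => (hC _ (hPmem E)).trans (Real.le_coe_toNNReal C)) x₀
  have hd1 : ∀ i t, 0 ≤ t → HasDerivWithinAt (fun s => (x s).1 i) ((M.field (P (x t))).1 i)
      (Set.Ici 0) t := fun i t ht => (hasDerivWithinAt_pi.1 (hx t ht).fst) i
  have hd2 : ∀ i t, 0 ≤ t → HasDerivWithinAt (fun s => (x s).2 i) ((M.field (P (x t))).2 i)
      (Set.Ici 0) t := fun i t ht => (hasDerivWithinAt_pi.1 (hx t ht).snd) i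
  have hc1 := mem_cube.1 hx₀.1
  have hc2 := mem_cube.1 hx₀.2
  have hmem : ∀ t, 0 ≤ t → x t ∈ domain N := by
    intro t ht
    refine ⟨mem_cube.2 fun i => ⟨?_, ?_⟩, mem_cube.2 fun i => ⟨?_, ?_⟩⟩
    · refine nonneg_of_deriv_nonneg_of_neg (hd1 i) (hx0 ▸ (hc1 i).1) (fun s _ hneg => ?_) t ht
      have e : (P (x s)).1 i = 0 := by
        simp [hP, clamp, hneg.le]
      have hp := hPmem (x s)
      have := mem_cube.1 hp.2 i
      have := M.fU_rate.nonneg i hp.1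
      have := M.fT_rate.nonneg i hp.1
      simp only [field, e]
      nlinarith
    · have := nonneg_of_deriv_nonneg_of_neg (fun s hs => (hd1 i s hs).const_sub 1)
        (by rw [hx0]; linarith [(hc1 i).2]) (fun s _ hneg => ?_) t ht
      · linarith
      -- On this face `1 - R_i - T_i = -T_i` may be negative; `fT ≤ fU` then makes the sum of the
      -- two gain terms nonpositive.
      have e : (P (x s)).1 i = 1 := by
        have : 1 ≤ (x s).1 i := by linarith
        simp [hP, clamp, this]
      have hp := hPmem (x s)
      have := mem_cube.1 hp.2 i
      have := M.ordering_f i _ hp.1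
      have := M.gR_rate.nonneg i hp.2
      have := M.δR_pos i
      simp only [field, e]
      nlinarith
    · refine nonneg_of_deriv_nonneg_of_neg (hd2 i) (hx0 ▸ (hc2 i).1) (fun s _ hneg => ?_) t ht
      have e : (P (x s)).2 i = 0 := by
        simp [hP, clamp, hneg.le]
      have hp := hPmem (x s)
      have := mem_cube.1 hp.1 i
      have := M.gU_rate.nonneg i hp.2
      have := M.gR_rate.nonneg i hp.2
      simp only [field, e]
      nlinarith
    · have := nonneg_of_deriv_nonneg_of_neg (fun s hs => (hd2 i s hs).const_sub 1)
        (by rw [hx0]; linarith [(hc2 i).2]) (fun s _ hneg => ?_) t ht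
      · linarith
      have e : (P (x s)).2 i = 1 := by
        have : 1 ≤ (x s).2 i := by linarith
        simp [hP, clamp, this]
      have hp := hPmem (x s)
      have := mem_cube.1 hp.1 i
      have := M.ordering_g i _ hp.2
      have := M.fT_rate.nonneg i hp.1
      have := M.δT_pos i
      simp only [field, e]
      nlinarith
  refine ⟨x, fun t ht => ⟨hmem t ht, ?_⟩, hx0⟩
  have hPx : P (x t) = x t :=
    Prod.ext (clamp_of_mem (hmem t ht).1) (clamp_of_mem (hmem t ht).2)
  simpa [hPx] using hx t ht

end Model

end URTU

/-! ### The positive equilibrium -/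

namespace URTU

variable {N : ℕ}

lemma exists_pos_forall_le {ι : Type*} [Finite ι] {w : ι → ℝ} (hw : ∀ i, 0 < w i) :
    ∃ c > 0, ∀ i, c ≤ w i := by
  cases isEmpty_or_nonempty ι
  · exact ⟨1, one_pos, fun i => isEmptyElim i⟩
  · obtain ⟨i, hi⟩ := Finite.exists_min w
    exact ⟨w i, hw i, hi⟩

lemma pos_of_equilibrium {a b δ : ℝ} (ha : 0 ≤ a) (hδ : 0 < δ) (hb : 0 < b)
    (h : (1 - b) * a = δ * b) : 0 < a := by
  refine lt_of_le_of_ne ha fun h0 => ?_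
  rw [← h0, mul_zero] at h
  exact (mul_pos hδ hb).ne h

namespace IsSpreadingRate

variable {G : Digraph (Fin N)} {f : Fin N → (Fin N → ℝ) → ℝ}

/-- By strong connectivity, a nonzero state is positive if no rate at which a message reaches a
zero coordinate is positive. -/
lemma forall_pos (hf : IsSpreadingRate G f) (hG : StronglyConnected G) {x : Fin N → ℝ}
    (hx : x ∈ cube N) (h : ∀ i, x i = 0 → f i x ≤ 0) (hx0 : x ≠ 0) (i : Fin N) : 0 < x i := by
  refine lt_of_le_of_ne (hx.1 i) fun hi => hx0 (funext fun j => ?_)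
  have := hG i j
  -- A zero at `b` forces `f b x ≤ 0`, hence a zero at each `c` with `G.Adj b c`; zeros spread along
  -- paths.
  induction this with
  | refl => exact hi.symm
  | tail _ hbc ih =>
    by_contra hne
    exact absurd (hf.pos hbc hx (lt_of_le_of_ne (hx.1 _) (Ne.symm hne))) (not_lt.2 (h _ ih))

/-- The linearization at the origin has a positive eigenvector for its spectral abscissa. -/
lemma exists_pos_eigenvector_jacobianZero [Nonempty (Fin N)] (hf : IsSpreadingRate G f)
    (hG : StronglyConnected G) (δ : Fin N → ℝ) :
    ∃ v : Fin N → ℝ, (∀ i, 0 < v i) ∧ ∀ i, ∑ j, partialDeriv (f i) j 0 * v j =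
      (δ i + spectralAbscissa (jacobianZero f - Matrix.diagonal δ)) * v i := by
  set Q := jacobianZero f - Matrix.diagonal δ with hQ
  have hoff : ∀ i j, i ≠ j → Q i j = partialDeriv (f i) j 0 := fun i j h => by
    simp [hQ, jacobianZero, h]
  have hnn : ∀ i j, i ≠ j → 0 ≤ Q i j := fun i j h => by
    rw [hoff i j h]; exact hf.partialDeriv_nonneg i j zero_mem_cube
  have hadj : ∀ i j, G.Adj i j → i ≠ j → 0 < Q i j := fun i j hij h => by
    rw [hoff i j h]; exact hf.monotonicity i j ((hf.proximity i j).2 hij) 0 zero_mem_cube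
  obtain ⟨v, r, hv, hvr⟩ := exists_pos_eigenvector hnn fun i j =>
    (Relation.ReflTransGen.mono hadj) _ _ (hG i j)
  have hr : IsGreatest (Complex.re '' spectrum ℂ (Q.map Complex.ofReal)) r :=
    ⟨⟨r, ofReal_mem_spectrum hv hvr, Complex.ofReal_re r⟩, by
      rintro _ ⟨μ, hμ, rfl⟩
      exact re_le_of_mem_spectrum hnn hv hvr hμ⟩
  have hs : spectralAbscissa Q = r := hr.csSup_eq
  refine ⟨v, hv, fun i => ?_⟩
  have h1 := congrFun hvr i
  rw [hQ, Matrix.sub_mulVec, Pi.sub_apply, Matrix.mulVec_diagonal] at h1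
  have h2 : (jacobianZero f).mulVec v i = ∑ j, partialDeriv (f i) j 0 * v j := rfl
  rw [hs, ← h2]
  simp only [Pi.smul_apply, smul_eq_mul] at h1
  linarith

/-- A network with positive spectral abscissa has a positive equilibrium. -/
lemma exists_pos_equilibrium (hf : IsSpreadingRate G f) (hG : StronglyConnected G)
    {δ : Fin N → ℝ} (hδ : ∀ i, 0 < δ i)
    (hs : 0 < spectralAbscissa (jacobianZero f - Matrix.diagonal δ)) [Nonempty (Fin N)] :
    ∃ x ∈ cube N, (∀ i, 0 < x i) ∧ ∀ i, (1 - x i) * f i x = δ i * x i := by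
  obtain ⟨v, hv, hve⟩ := hf.exists_pos_eigenvector_jacobianZero hG δ
  set s := spectralAbscissa (jacobianZero f - Matrix.diagonal δ)
  -- Solving the equilibrium equation for `x i` outside `f` gives a monotone self-map of the cube.
  -- As in Knaster–Tarski, the supremum of the points with `x ≤ Φ x` is fixed.
  set Φ : (Fin N → ℝ) → Fin N → ℝ := fun x i => f i x / (δ i + f i x) with hΦ
  have hden : ∀ x ∈ cube N, ∀ i, 0 < δ i + f i x := fun x hx i =>
    add_pos_of_pos_of_nonneg (hδ i) (hf.nonneg i hx)
  have hΦc : ∀ x ∈ cube N, Φ x ∈ cube N := fun x hx => mem_cube.2 fun i =>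
    ⟨div_nonneg (hf.nonneg i hx) (hden x hx i).le,
      (div_le_one (hden x hx i)).2 (by linarith [hδ i])⟩
  have hΦm : MonotoneOn Φ (cube N) := by
    intro x hx y hy hxy i
    have h1 := hf.monotoneOn i hx hy hxy
    rw [hΦ, div_le_div_iff₀ (hden x hx i) (hden y hy i)]
    nlinarith [hδ i]
  set S : Set (Fin N → ℝ) := {x ∈ cube N | x ≤ Φ x} with hS
  have hSb : BddAbove S := ⟨1, fun x hx => hx.1.2⟩
  have hS0 : (0 : Fin N → ℝ) ∈ S := ⟨zero_mem_cube, (hΦc 0 zero_mem_cube).1⟩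
  set R := sSup S with hR
  have hle : ∀ x ∈ S, x ≤ R := fun x hx => le_csSup hSb hx
  have hRc : R ∈ cube N := ⟨hle 0 hS0, csSup_le ⟨0, hS0⟩ fun x hx => hx.1.2⟩
  have hRΦ : R ≤ Φ R := csSup_le ⟨0, hS0⟩ fun x hx =>
    hx.2.trans (hΦm hx.1 hRc (hle x hx))
  have hfix : Φ R = R := le_antisymm (hle _ ⟨hΦc R hRc, hΦm hRc (hΦc R hRc) hRΦ⟩) hRΦ
  have heq : ∀ i, (1 - R i) * f i R = δ i * R i := by
    intro i
    have h1 : f i R / (δ i + f i R) = R i := congrFun hfix i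
    rw [div_eq_iff (hden R hRc i).ne'] at h1
    linarith
  refine ⟨R, hRc, hf.forall_pos hG hRc (fun i hi => ?_) ?_, heq⟩
  · have := heq i
    simp only [hi, sub_zero, one_mul, mul_zero] at this
    exact this.le
  · set c := ∑ i, v i with hc
    have hcv : ∀ i, v i ≤ c := fun i =>
      Finset.single_le_sum (fun j _ => (hv j).le) (Finset.mem_univ i)
    have hcpos : 0 < c := (hv (Classical.arbitrary _)).trans_le (hcv _)
    set w := c⁻¹ • v with hw
    have hwpos : ∀ i, 0 < w i := fun i => mul_pos (inv_pos.2 hcpos) (hv i)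
    have hwc : w ∈ cube N := mem_cube.2 fun i => ⟨(hwpos i).le, by
      rw [hw, Pi.smul_apply, smul_eq_mul, inv_mul_le_one₀ hcpos]; exact hcv i⟩
    have hwe : ∀ i, ∑ j, partialDeriv (f i) j 0 * w j = (δ i + s) * w i := by
      intro i
      have : ∑ j, partialDeriv (f i) j 0 * w j = c⁻¹ * ∑ j, partialDeriv (f i) j 0 * v j := by
        rw [Finset.mul_sum]
        exact Finset.sum_congr rfl fun j _ => by simp only [hw, Pi.smul_apply, smul_eq_mul]; ring
      rw [this, hve, hw, Pi.smul_apply, smul_eq_mul]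
      ring
    -- Half of `s` is given up to nonlinearity; the other half pays for saturation, as `(δ i + s /
    -- 2) * (1 - ε) ≥ δ i` for `ε` at most `c₁`.
    have hev : ∀ i, ∀ᶠ ε : ℝ in 𝓝[>] 0, ε * ((δ i + s / 2) * w i) < f i (ε • w) := fun i =>
      hf.eventually_lt_smul i hwc (by rw [hwe]; nlinarith [hwpos i])
    obtain ⟨c₁, hc₁, hc₁s⟩ := exists_pos_forall_le
      (w := fun i => s / 2 / (δ i + s / 2)) fun i => div_pos (by linarith) (by linarith [hδ i])
    obtain ⟨ε, hε, hε0, hε1⟩ := ((eventually_all.2 hev).and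
      (Ioc_mem_nhdsGT (lt_min one_pos hc₁))).exists
    have hεw : ε • w ∈ cube N := smul_mem_cube hwc hε0.le (hε1.trans (min_le_left _ _))
    have hmem : ε • w ∈ S := by
      refine ⟨hεw, fun i => ?_⟩
      have h1 := hε i
      have h2 : ε ≤ s / 2 / (δ i + s / 2) := (hε1.trans (min_le_right _ _)).trans (hc₁s i)
      rw [le_div_iff₀ (by linarith [hδ i])] at h2
      rw [hΦ, le_div_iff₀ (hden _ hεw i), Pi.smul_apply, smul_eq_mul]
      have h3 : 0 < ε * w i := mul_pos hε0 (hwpos i)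
      have h4 : ε * w i ≤ ε := mul_le_of_le_one_right hε0.le (hwc.2 i)
      have h5 : (δ i + s / 2) * (1 - ε) ≥ δ i := by linarith
      have h6 : 0 ≤ 1 - ε * w i := by nlinarith [hε1.trans (min_le_left _ _)]
      nlinarith [mul_le_mul_of_nonneg_left h1.le h6, mul_le_mul_of_nonneg_left h5 h3.le,
        mul_nonneg (mul_nonneg h3.le (by linarith [hδ i] : 0 ≤ δ i + s / 2)) (sub_nonneg.2 h4)]
    intro hR0
    have := hle _ hmem (Classical.arbitrary _)
    rw [hR0] at this
    exact absurd this (not_le.2 (mul_pos hε0 (hwpos _)))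

end IsSpreadingRate

/-! ### Long-time behaviour of solutions -/

namespace Model

variable {M : Model N} {x : ℝ → State N}

namespace IsSolution

lemma hasDerivWithinAt_fst (hx : M.IsSolution x) (i : Fin N) {t : ℝ} (ht : 0 ≤ t) :
    HasDerivWithinAt (fun s => (x s).1 i) ((M.field (x t)).1 i) (Set.Ici 0) t :=
  (hasDerivWithinAt_pi.1 (hx t ht).2.fst) i

lemma hasDerivWithinAt_snd (hx : M.IsSolution x) (i : Fin N) {t : ℝ} (ht : 0 ≤ t) :
    HasDerivWithinAt (fun s => (x s).2 i) ((M.field (x t)).2 i) (Set.Ici 0) t :=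
  (hasDerivWithinAt_pi.1 (hx t ht).2.snd) i

/-- Exchanges between rumor and truth cancel in `R_i + T_i`, whose derivative is nonpositive where
the sum exceeds 1. -/
lemma mem_Omega (hx : M.IsSolution x) (h0 : x 0 ∈ Omega N) {t : ℝ} (ht : 0 ≤ t) :
    x t ∈ Omega N := by
  intro i
  obtain ⟨h1, h2⟩ := (hx t ht).1
  refine ⟨h1.1 i, h2.1 i, ?_⟩
  have := nonneg_of_deriv_nonneg_of_neg
    (fun s hs => ((hx.hasDerivWithinAt_fst i hs).fun_add (hx.hasDerivWithinAt_snd i hs)).const_sub 1)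
    (by linarith [(h0 i).2.2]) (fun s hs hneg => ?_) t ht
  · linarith
  obtain ⟨h1, h2⟩ := (hx s hs).1
  have e1 := M.fU_rate.nonneg i h1
  have e2 := M.gU_rate.nonneg i h2
  have e3 := mul_nonneg (M.δR_pos i).le (h1.1 i)
  have e4 := mul_nonneg (M.δT_pos i).le (h2.1 i)
  have e5 : 0 ≤ ((x s).1 i + (x s).2 i - 1) * (M.fU i (x s).1 + M.gU i (x s).2) :=
    mul_nonneg (by linarith) (by linarith)
  simp only [field]
  linarith

/-- A rumor that is present stays present. -/
lemma fst_pos_of_pos (hx : M.IsSolution x) (h0 : x 0 ∈ Omega N) {i : Fin N}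
    (hi : 0 < (x 0).1 i) {t : ℝ} (ht : 0 ≤ t) : 0 < (x t).1 i := by
  -- `K` bounds the loss rate per rumor-believer, so `R_i * exp (K t)` never decreases.
  set K := M.δR i + M.gR i 1 with hK
  have hd : ∀ s, 0 ≤ s → HasDerivWithinAt (fun s => (x s).1 i * Real.exp (K * s) - (x 0).1 i)
      ((M.field (x s)).1 i * Real.exp (K * s) + (x s).1 i * (Real.exp (K * s) * K))
      (Set.Ici 0) s := by
    intro s hs
    have h1 : HasDerivAt (fun s => Real.exp (K * s)) (Real.exp (K * s) * K) s := by
      simpa using ((hasDerivAt_id s).const_mul K).exp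
    exact ((hx.hasDerivWithinAt_fst i hs).fun_mul h1.hasDerivWithinAt).sub_const _
  have h1 := nonneg_of_deriv_nonneg_of_neg hd (by simp) (fun s hs _ => ?_) t ht
  · have h2 : 0 < (x t).1 i * Real.exp (K * t) := by linarith
    exact pos_of_mul_pos_left h2 (Real.exp_pos _).le
  obtain ⟨hR, hT⟩ := (hx s hs).1
  obtain ⟨a1, a2, a3⟩ := hx.mem_Omega h0 hs i
  have e1 : 0 ≤ (1 - (x s).1 i - (x s).2 i) * M.fU i (x s).1 :=
    mul_nonneg (by linarith) (M.fU_rate.nonneg i hR)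
  have e2 := mul_nonneg a2 (M.fT_rate.nonneg i hR)
  have e3 : M.gR i (x s).2 ≤ M.gR i 1 :=
    M.gR_rate.monotoneOn i hT ⟨zero_le_one, le_rfl⟩ hT.2
  have e4 : 0 ≤ (M.field (x s)).1 i + (x s).1 i * K := by
    simp only [field, hK]
    nlinarith [mul_le_mul_of_nonneg_left e3 a1]
  have e5 := mul_nonneg e4 (Real.exp_pos (K * s)).le
  linarith

/-- A rumor that is present reaches everybody. -/
lemma fst_pos (hx : M.IsSolution x) (h0 : x 0 ∈ Omega N) (hR0 : (x 0).1 ≠ 0) {t : ℝ}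
    (ht : 0 < t) (i : Fin N) : 0 < (x t).1 i := by
  obtain ⟨hR, hT⟩ := (hx t ht.le).1
  refine M.fT_rate.forall_pos M.connected_GR hR (fun j hj => ?_) ?_ i
  · have hd : HasDerivAt (fun s => (x s).1 j) ((M.field (x t)).1 j) t :=
      (hx.hasDerivWithinAt_fst j ht.le).hasDerivAt (Ici_mem_nhds ht)
    -- A zero at time `t > 0` is a two-sided minimum, so the inflow `(1 - T_j) fU + T_j fT`
    -- vanishes; it is at least `fT`.
    have hmin : IsLocalMin (fun s => (x s).1 j) t := by
      filter_upwards [Ici_mem_nhds ht] with s hs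
      rw [hj]
      exact (hx s hs).1.1.1 j
    have h1 := hmin.hasDerivAt_eq_zero hd
    simp only [field, hj] at h1
    have h2 := M.ordering_f j _ hR
    have h3 := hT.2 j
    simp only [Pi.one_apply] at h3
    nlinarith [mul_le_mul_of_nonneg_left h2 (sub_nonneg.2 h3)]
  · obtain ⟨k, hk⟩ := Function.ne_iff.1 hR0
    intro h
    have := hx.fst_pos_of_pos h0 (lt_of_le_of_ne ((h0 k).1) (Ne.symm hk)) ht.le
    simp [h] at this

/-- The truth dies out, if its linearization has a positive subsolution. -/
lemma eventually_snd_le (hx : M.IsSolution x) (h0 : x 0 ∈ Omega N) {v : Fin N → ℝ}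
    (hv : ∀ i, 0 < v i) (hve : ∀ i, ∑ j, partialDeriv (M.gU i) j 0 * v j ≤ M.δT i * v i)
    {ε : ℝ} (hε : 0 < ε) : ∀ᶠ t in atTop, ∀ i, (x t).2 i ≤ ε * v i := by
  obtain ⟨c, hc, hcle⟩ := exists_pos_forall_le fun i => mul_pos (M.δT_pos i) (hv i)
  have := eventually_forall_le_of_deriv_lt (u := fun i t => (x t).2 i / v i)
    (u' := fun i t => (M.field (x t)).2 i / v i) (a := 0) (ε := ε) (η := c * ε ^ 2 / 2)
    (by positivity) (fun i t ht => (hx.hasDerivWithinAt_snd i ht).div_const _) ?_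
  · filter_upwards [this] with t ht i using (div_le_iff₀ (hv i)).1 (ht i)
  intro i t ht hmax hi
  obtain ⟨hR, hT⟩ := (hx t ht).1
  obtain ⟨a1, a2, a3⟩ := hx.mem_Omega h0 ht i
  set m := (x t).2 i / v i with hm
  have hTi : (x t).2 i = m * v i := by rw [hm]; field_simp [(hv i).ne']
  have hle : ∀ j, (x t).2 j ≤ m * v j := fun j => (div_le_iff₀ (hv j)).1 (hmax j)
  have hm0 : 0 < m := hε.trans_le hi
  have e1 : M.gU i (x t).2 ≤ M.δT i * (x t).2 i := by
    calc M.gU i (x t).2 ≤ ∑ j, partialDeriv (M.gU i) j 0 * (x t).2 j :=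
          M.gU_rate.le_sum_partialDeriv_zero i hT
      _ ≤ ∑ j, partialDeriv (M.gU i) j 0 * (m * v j) := Finset.sum_le_sum fun j _ =>
          mul_le_mul_of_nonneg_left (hle j) (M.gU_rate.partialDeriv_nonneg i j zero_mem_cube)
      _ = m * ∑ j, partialDeriv (M.gU i) j 0 * v j := by
          rw [Finset.mul_sum]; exact Finset.sum_congr rfl fun j _ => by ring
      _ ≤ m * (M.δT i * v i) := mul_le_mul_of_nonneg_left (hve i) hm0.le
      _ = M.δT i * (x t).2 i := by rw [hTi]; ring
  have e2 := mul_le_mul_of_nonneg_left (M.ordering_g i _ hT) a1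
  have e3 := mul_nonneg a2 (M.fT_rate.nonneg i hR)
  have e4 : (1 - (x t).2 i) * M.gU i (x t).2 ≤ (1 - (x t).2 i) * (M.δT i * (x t).2 i) :=
    mul_le_mul_of_nonneg_left e1 (by linarith)
  -- The linear terms cancel, and the saturation factor leaves `-δ_i T_i ^ 2`.
  have e5 : (M.field (x t)).2 i ≤ -(M.δT i * v i * m ^ 2) * v i := by
    have : -(M.δT i * v i * m ^ 2) * v i = -M.δT i * (x t).2 i ^ 2 := by rw [hTi]; ring
    rw [this]
    simp only [field]
    linarith
  have e6 : c * ε ^ 2 ≤ M.δT i * v i * m ^ 2 :=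
    mul_le_mul (hcle i) (pow_le_pow_left₀ hε.le hi 2) (by positivity)
      (mul_pos (M.δT_pos i) (hv i)).le
  have e7 : 0 < c * ε ^ 2 := by positivity
  change (M.field (x t)).2 i / v i < _
  rw [div_lt_iff₀ (hv i)]
  refine e5.trans_lt (mul_lt_mul_of_pos_right ?_ (hv i))
  linarith

/-- The rumor does not exceed its equilibrium by more than a given proportion in the long run. -/
lemma eventually_fst_le (hx : M.IsSolution x) (h0 : x 0 ∈ Omega N) {y : Fin N → ℝ}
    (hy : y ∈ cube N) (hypos : ∀ i, 0 < y i) (hye : ∀ i, (1 - y i) * M.fU i y = M.δR i * y i)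
    {ε : ℝ} (hε : 0 < ε) : ∀ᶠ t in atTop, ∀ i, (x t).1 i ≤ (1 + ε) * y i := by
  have hF : ∀ i, 0 < M.fU i y := fun i =>
    pos_of_equilibrium (M.fU_rate.nonneg i hy) (M.δR_pos i) (hypos i) (hye i)
  obtain ⟨c, hc, hcle⟩ := exists_pos_forall_le hF
  have := eventually_forall_le_of_deriv_lt (u := fun i t => (x t).1 i / y i)
    (u' := fun i t => (M.field (x t)).1 i / y i) (a := 0) (ε := 1 + ε) (η := c * ε / 2)
    (by positivity) (fun i t ht => (hx.hasDerivWithinAt_fst i ht).div_const _) ?_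
  · filter_upwards [this] with t ht i using (div_le_iff₀ (hypos i)).1 (ht i)
  intro i t ht hmax hi
  obtain ⟨hR, hT⟩ := (hx t ht).1
  obtain ⟨a1, a2, a3⟩ := hx.mem_Omega h0 ht i
  set m := (x t).1 i / y i with hm
  have hRi : (x t).1 i = m * y i := by rw [hm]; field_simp [(hypos i).ne']
  have hle : ∀ j, (x t).1 j ≤ m * y j := fun j => (div_le_iff₀ (hypos j)).1 (hmax j)
  have hm1 : 1 < m := by linarith
  have hm0 : 0 < m := by linarith
  -- Subhomogeneity with factor `1 / m`, as `R / m ≤ y`.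
  have e1 : M.fU i (x t).1 ≤ m * M.fU i y := by
    have h1 := M.fU_rate.mul_le_smul i hR (inv_nonneg.2 hm0.le) (inv_le_one_of_one_le₀ hm1.le)
    have h2 := M.fU_rate.monotoneOn i
      (smul_mem_cube hR (inv_nonneg.2 hm0.le) (inv_le_one_of_one_le₀ hm1.le)) hy fun j => by
        rw [Pi.smul_apply, smul_eq_mul, inv_mul_le_iff₀ hm0]; exact hle j
    exact (inv_mul_le_iff₀ hm0).1 (h1.trans h2)
  have e2 := mul_le_mul_of_nonneg_left (M.ordering_f i _ hR) a2
  have e3 := mul_nonneg a1 (M.gR_rate.nonneg i hT)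
  have e4 : (1 - (x t).1 i) * M.fU i (x t).1 ≤ (1 - (x t).1 i) * (m * M.fU i y) :=
    mul_le_mul_of_nonneg_left e1 (by linarith)
  have e5 : (M.field (x t)).1 i ≤ -(m * (m - 1) * M.fU i y) * y i := by
    have : -(m * (m - 1) * M.fU i y) * y i
        = (1 - (x t).1 i) * (m * M.fU i y) - M.δR i * (x t).1 i := by
      rw [hRi]
      linear_combination (-m) * hye i
    rw [this]
    simp only [field]
    linarith
  have e6 : c * ε ≤ m * (m - 1) * M.fU i y := by
    have h1 : ε ≤ m * (m - 1) := by nlinarith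
    rw [mul_comm c ε]
    exact mul_le_mul h1 (hcle i) hc.le (hε.le.trans h1)
  have e7 : 0 < c * ε := by positivity
  change (M.field (x t)).1 i / y i < _
  rw [div_lt_iff₀ (hypos i)]
  refine e5.trans_lt (mul_lt_mul_of_pos_right ?_ (hypos i))
  linarith

/-- The rumor does not fall below its equilibrium by more than a given proportion in the long
run, if the truth dies out. -/
lemma eventually_le_fst (hx : M.IsSolution x) (h0 : x 0 ∈ Omega N) (hR0 : (x 0).1 ≠ 0)
    {v : Fin N → ℝ} (hv : ∀ i, 0 < v i)
    (hve : ∀ i, ∑ j, partialDeriv (M.gU i) j 0 * v j ≤ M.δT i * v i) {y : Fin N → ℝ}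
    (hy : y ∈ cube N) (hypos : ∀ i, 0 < y i) (hye : ∀ i, (1 - y i) * M.fU i y = M.δR i * y i)
    {ε : ℝ} (hε : 0 < ε) : ∀ᶠ t in atTop, ∀ i, y i ≤ (1 + ε) * (x t).1 i := by
  have hF : ∀ i, 0 < M.fU i y := fun i =>
    pos_of_equilibrium (M.fU_rate.nonneg i hy) (M.δR_pos i) (hypos i) (hye i)
  obtain ⟨c, hc, hcle⟩ := exists_pos_forall_le hF
  set θ := ε / (1 + ε) with hθ
  have hθ0 : 0 < θ := by positivity
  -- With `T ≤ κ v`, the losses due to truth consume at most half of the rumor's guaranteed growth.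
  obtain ⟨κ, hκ, hκle⟩ := exists_pos_forall_le
    (w := fun i => θ * (y i * M.fU i y) / 2 / (v i * M.fU i y + M.δT i * v i * y i)) fun i => by
      have := hF i
      have := hypos i
      have := hv i
      have := M.δT_pos i
      positivity
  obtain ⟨a, ha1, ha⟩ : ∃ a : ℝ, 1 ≤ a ∧ ∀ t, a ≤ t → ∀ i, (x t).2 i ≤ κ * v i := by
    obtain ⟨a, ha⟩ := eventually_atTop.1 (hx.eventually_snd_le h0 hv hve hκ)
    exact ⟨max 1 a, le_max_left _ _, fun t ht => ha t ((le_max_right _ _).trans ht)⟩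
  have hpos : ∀ t, a ≤ t → ∀ i, 0 < (x t).1 i := fun t ht i =>
    hx.fst_pos h0 hR0 (by linarith) i
  have := eventually_forall_le_of_deriv_lt (u := fun i t => y i / (x t).1 i)
    (u' := fun i t => y i * (-(M.field (x t)).1 i / (x t).1 i ^ 2)) (a := a) (ε := 1 + ε)
    (η := θ * c / 4) (by positivity) (fun i t ht => by
      have h1 := (hx.hasDerivWithinAt_fst i (by linarith : 0 ≤ t)).mono
        (Set.Ici_subset_Ici.2 (by linarith : 0 ≤ a))
      simpa only [div_eq_mul_inv] using (h1.fun_inv (hpos t ht i).ne').const_mul (y i)) ?_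
  · filter_upwards [this, eventually_ge_atTop a] with t ht hat i
    exact (div_le_iff₀ (hpos t hat i)).1 (ht i)
  intro i t hat hmax hi
  have ht : 0 ≤ t := by linarith
  obtain ⟨hR, hT⟩ := (hx t ht).1
  obtain ⟨a1, a2, a3⟩ := hx.mem_Omega h0 ht i
  have hRpos := hpos t hat
  set ρ := (x t).1 i / y i with hρ
  have hρ0 : 0 < ρ := div_pos (hRpos i) (hypos i)
  have hRi : (x t).1 i = ρ * y i := by rw [hρ]; field_simp [(hypos i).ne']
  have hρle : ρ * (1 + ε) ≤ 1 := by
    rw [le_div_iff₀ (hRpos i), hRi] at hi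
    refine le_of_mul_le_mul_right ?_ (hypos i)
    linarith
  -- `θ` is `1 - 1 / (1 + ε)`, the guaranteed relative deficit at the minimizing index of `R_j /
  -- y_j`.
  have hρθ : θ ≤ 1 - ρ := by
    rw [hθ, div_le_iff₀ (by linarith)]
    linarith
  have hle : ∀ j, ρ * y j ≤ (x t).1 j := by
    intro j
    have h1 : y j / (x t).1 j ≤ y i / (x t).1 i := hmax j
    rw [div_le_div_iff₀ (hRpos j) (hRpos i), hRi] at h1
    refine le_of_mul_le_mul_right ?_ (hypos i)
    linarith
  have e1 : ρ * M.fU i y ≤ M.fU i (x t).1 := by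
    have hρ1 : ρ ≤ 1 := by linarith
    exact (M.fU_rate.mul_le_smul i hy hρ0.le hρ1).trans
      (M.fU_rate.monotoneOn i (smul_mem_cube hy hρ0.le hρ1) hR hle)
  have e2 := mul_nonneg a2 (M.fT_rate.nonneg i hR)
  have e3 : M.gR i (x t).2 ≤ κ * (M.δT i * v i) := by
    calc M.gR i (x t).2 ≤ M.gU i (x t).2 := M.ordering_g i _ hT
      _ ≤ ∑ j, partialDeriv (M.gU i) j 0 * (x t).2 j := M.gU_rate.le_sum_partialDeriv_zero i hT
      _ ≤ ∑ j, partialDeriv (M.gU i) j 0 * (κ * v j) := Finset.sum_le_sum fun j _ =>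
          mul_le_mul_of_nonneg_left (ha t hat j)
            (M.gU_rate.partialDeriv_nonneg i j zero_mem_cube)
      _ = κ * ∑ j, partialDeriv (M.gU i) j 0 * v j := by
          rw [Finset.mul_sum]; exact Finset.sum_congr rfl fun j _ => by ring
      _ ≤ κ * (M.δT i * v i) := mul_le_mul_of_nonneg_left (hve i) hκ.le
  have e4 : (1 - (x t).1 i - (x t).2 i) * (ρ * M.fU i y)
      ≤ (1 - (x t).1 i - (x t).2 i) * M.fU i (x t).1 :=
    mul_le_mul_of_nonneg_left e1 (by linarith)
  have e5 : (x t).2 i * (ρ * M.fU i y) ≤ κ * v i * (ρ * M.fU i y) :=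
    mul_le_mul_of_nonneg_right (ha t hat i) (mul_pos hρ0 (hF i)).le
  have e6 : (x t).1 i * M.gR i (x t).2 ≤ (x t).1 i * (κ * (M.δT i * v i)) :=
    mul_le_mul_of_nonneg_left e3 a1
  have e7 : κ * (v i * M.fU i y + M.δT i * v i * y i) ≤ θ * (y i * M.fU i y) / 2 := by
    refine (le_div_iff₀ ?_).1 (hκle i)
    have := hF i
    have := hypos i
    have := hv i
    have := M.δT_pos i
    positivity
  have e8 : ρ * (θ * (y i * M.fU i y) / 2) ≤ (M.field (x t)).1 i := by
    have h1 : ρ * ((1 - ρ) * (y i * M.fU i y) - κ * (v i * M.fU i y + M.δT i * v i * y i))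
        = (1 - (x t).1 i) * (ρ * M.fU i y) - κ * v i * (ρ * M.fU i y) - M.δR i * (x t).1 i
          - (x t).1 i * (κ * (M.δT i * v i)) := by
      rw [hRi]
      linear_combination (-ρ) * hye i
    have h2 : θ * (y i * M.fU i y) ≤ (1 - ρ) * (y i * M.fU i y) :=
      mul_le_mul_of_nonneg_right hρθ (mul_pos (hypos i) (hF i)).le
    have h3 := mul_le_mul_of_nonneg_left
      (by linarith : θ * (y i * M.fU i y) / 2 ≤
        (1 - ρ) * (y i * M.fU i y) - κ * (v i * M.fU i y + M.δT i * v i * y i)) hρ0.le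
    rw [h1] at h3
    simp only [field]
    linarith
  have e9 : y i * (-(M.field (x t)).1 i / (x t).1 i ^ 2) ≤ -(θ * M.fU i y / 2) := by
    rw [← mul_div_assoc, div_le_iff₀ (pow_pos (hRpos i) 2), hRi]
    have h1 := mul_le_mul_of_nonneg_left e8 (hypos i).le
    have h2 : 0 ≤ θ * M.fU i y / 2 * y i ^ 2 := by
      have := hF i
      positivity
    have h3 : ρ ^ 2 ≤ ρ := by nlinarith
    have h4 := mul_le_mul_of_nonneg_right h3 h2
    nlinarith
  have e10 : θ * c ≤ θ * M.fU i y := mul_le_mul_of_nonneg_left (hcle i) hθ0.le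
  have e11 : 0 < θ * c := by positivity
  change y i * (-(M.field (x t)).1 i / (x t).1 i ^ 2) < _
  linarith

/-- Solutions with a rumor converge to the rumor-dominant equilibrium. -/
lemma tendsto_rumorDominant (hx : M.IsSolution x) (h0 : x 0 ∈ Omega N) (hR0 : (x 0).1 ≠ 0)
    {v : Fin N → ℝ} (hv : ∀ i, 0 < v i)
    (hve : ∀ i, ∑ j, partialDeriv (M.gU i) j 0 * v j ≤ M.δT i * v i) {y : Fin N → ℝ}
    (hy : y ∈ cube N) (hypos : ∀ i, 0 < y i) (hye : ∀ i, (1 - y i) * M.fU i y = M.δR i * y i) :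
    Tendsto x atTop (𝓝 (y, 0)) := by
  refine Tendsto.prodMk_nhds (mx := fun t => (x t).1) (my := fun t => (x t).2)
    (tendsto_pi_nhds.2 fun i => ?_) (tendsto_pi_nhds.2 fun i => ?_)
  · refine Metric.tendsto_nhds.2 fun ε hε => ?_
    filter_upwards [hx.eventually_fst_le h0 hy hypos hye (half_pos hε),
      hx.eventually_le_fst h0 hR0 hv hve hy hypos hye (half_pos hε),
      eventually_ge_atTop 0] with t h1 h2 ht
    have h3 : y i ≤ 1 := hy.2 i
    have h4 : (x t).1 i ≤ 1 := (hx t ht).1.1.2 i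
    have h5 := h1 i
    have h6 := h2 i
    rw [Real.dist_eq, abs_lt]
    constructor <;> nlinarith
  · refine Metric.tendsto_nhds.2 fun ε hε => ?_
    have hvi := hv i
    filter_upwards [hx.eventually_snd_le h0 hv hve (by positivity : 0 < ε / (2 * v i)),
      eventually_ge_atTop 0] with t h1 ht
    have h2 : 0 ≤ (x t).2 i := (hx t ht).1.2.1 i
    have h3 := h1 i
    have h4 : ε / (2 * v i) * v i = ε / 2 := by field_simp
    rw [Pi.zero_apply, Real.dist_eq, sub_zero, abs_of_nonneg h2]
    linarith

end IsSolution

end Model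

lemma continuous_mean : Continuous (mean (N := N)) := by
  unfold mean
  fun_prop

end URTU

/-! ### The theorem -/

theorem theorem3 {N : ℕ} (M : URTU.Model N)
    (hQ1 : 0 < URTU.spectralAbscissa M.Q1) (hQ2 : URTU.spectralAbscissa M.Q2 ≤ 0) :
    ∃ E : URTU.State N,
      (M.IsRumorDominantEquilibrium E ∧
        ∀ E' : URTU.State N, M.IsRumorDominantEquilibrium E' → E' = E) ∧
      M.Attracts E {x | x ∈ URTU.Omega N ∧ x.1 ≠ 0} ∧
      ∀ x : ℝ → URTU.State N, M.IsSolution x → x 0 ∈ URTU.Omega N →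
        URTU.mean (x 0).1 ≠ 0 →
        Filter.Tendsto (fun t => URTU.mean (x t).1) Filter.atTop (nhds (URTU.mean E.1)) ∧
        Filter.Tendsto (fun t => URTU.mean (x t).2) Filter.atTop (nhds 0) := by
  have hN : Nonempty (Fin N) := by
    by_contra hN
    rw [not_nonempty_iff] at hN
    -- For `N = 0` the spectrum is empty and `sSup ∅ = 0`, contrary to `hQ1`.
    simp [URTU.spectralAbscissa] at hQ1
  obtain ⟨v, hv, hve⟩ := M.gU_rate.exists_pos_eigenvector_jacobianZero M.connected_GT M.δT
  replace hve : ∀ i, ∑ j, URTU.partialDeriv (M.gU i) j 0 * v j ≤ M.δT i * v i := fun i => by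
    rw [hve i]
    exact mul_le_mul_of_nonneg_right (add_le_of_nonpos_right hQ2) (hv i).le
  obtain ⟨y, hy, hypos, hye⟩ := M.fU_rate.exists_pos_equilibrium M.connected_GR M.δR_pos hQ1
  have hconv : ∀ x, M.IsSolution x → x 0 ∈ URTU.Omega N → (x 0).1 ≠ 0 →
      Tendsto x atTop (𝓝 (y, 0)) := fun x hx h0 hR0 =>
    hx.tendsto_rumorDominant h0 hR0 hv hve hy hypos hye
  refine ⟨(y, 0), ⟨⟨⟨hy, URTU.zero_mem_cube⟩, ?_, ?_, rfl⟩, ?_⟩, ?_, ?_⟩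
  · ext i
    · simp [URTU.Model.field, M.gR_rate.nullity, hye i]
    · simp [URTU.Model.field, M.gR_rate.nullity, M.gU_rate.nullity]
  · obtain ⟨i⟩ := hN
    exact fun h => (hypos i).ne' (congrFun h i)
  · rintro E ⟨hE, hE0, hE1, hE2⟩
    -- A competing equilibrium is a constant solution, hence equal to its limit `(y, 0)`.
    have hsol : M.IsSolution fun _ => E := fun t _ =>
      ⟨hE, by rw [hE0]; exact hasDerivWithinAt_const _ _ _⟩
    have hΩ : E ∈ URTU.Omega N := fun i => by
      have := URTU.mem_cube.1 hE.1 i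
      simp [hE2, this.1, this.2]
    exact tendsto_nhds_unique tendsto_const_nhds (hconv _ hsol hΩ hE1)
  · rintro x₀ ⟨hΩ, hR⟩
    refine ⟨M.exists_isSolution ⟨URTU.mem_cube.2 fun i => ?_, URTU.mem_cube.2 fun i => ?_⟩, ?_⟩
    · obtain ⟨h1, h2, h3⟩ := hΩ i
      exact ⟨h1, by linarith⟩
    · obtain ⟨h1, h2, h3⟩ := hΩ i
      exact ⟨h2, by linarith⟩
    · rintro x hx rfl
      exact hconv x hx hΩ hR
  · intro x hx h0 hm
    have h1 := hconv x hx h0 fun h => hm (by simp [h, URTU.mean])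
    refine ⟨(URTU.continuous_mean.tendsto y).comp h1.fst_nhds, ?_⟩
    have h2 := (URTU.continuous_mean.tendsto (0 : Fin N → ℝ)).comp h1.snd_nhds
    simpa [URTU.mean, Function.comp_def] using h2
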